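/- Let $k$ be a field, let $\mathcal K=C(k)$ be the closed symmetric monoidal category of cochain complexes of $k$-vector spaces, and write $\underline{\mathcal K}(-,-)$ for its internal Hom complexes. Let $\underline{\mathcal M}$ be a $\mathcal K$-category (that is, a dg $k$-category) and let $\mathcal M$ be its underlying ordinary category, whose morphisms are the closed morphisms of degree zero. Assume that $\underline{\mathcal M}$ is *strongly pretriangulated*: writing $\mathrm{Yo}(X)=\underline{\mathcal M}(-,X)$ for the Yoneda functor from $\mathcal M$ to the category of right dg $\underline{\mathcal M}$-modules (with closed degree zero morphisms), the zero module, the shifts $[n]\mathrm{Yo}(X)$ for all $X\in\mathcal M$ and $n\in\mathbb Z$, and the cones $\mathrm{Cone}(\mathrm{Yo}(f))$ for all morphisms $f$ of $\mathcal M$, are isomorphic to modules of the form $\mathrm{Yo}(Z)$. This gives shift functors $[n]\colon\mathcal M\to\mathcal M$ and a cone functor $\mathrm{Cone}$ from arrows in $\mathcal M$ to $\mathcal M$, compatible with those of dg modules via $\mathrm{Yo}$, and the identity cone functor $\mathrm{iCone}\colon\mathcal M\to\mathcal M$, $X\mapsto\mathrm{Cone}(\mathrm{id}_X)$, $f\mapsto\mathrm{Cone}(f,f)$.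 Assume that $\underline{\mathcal M}$ is *$\mathcal K$-bicomplete*: it is tensored and cotensored over $\mathcal K$ (for all $K\in\mathcal K$ and $X,N\in\mathcal M$ there are objects $X\odot K$ and $\Psi(K,N)$ with dg natural isomorphisms $\underline{\mathcal M}(X\odot K,N)\cong\underline{\mathcal K}(K,\underline{\mathcal M}(X,N))\cong\underline{\mathcal M}(X,\Psi(K,N))$), and $\mathcal M$ has all small limits and colimits. Assume that $\mathcal M$ is equipped with a model structure turning it into a cofibrantly generated model category: there are sets $I$ and $J$ of morphisms, whose domains are small relative to the relative $I$-cell (respectively $J$-cell) complexes, such that the trivial fibrations are the morphisms with the right lifting property with respect to $I$ and the fibrations are those with the right lifting property with respect to $J$. Assume moreover that the class of cofibrations and the class of trivial cofibrations are each stable 1. under shifts: if $i\colon E\to F$ belongs to the class, so does $[n]i\colon[n]E\to[n]F$ for all $n\in\mathbb Z$; and 2. under the identity cone functor: if $i\colon E\to F$ belongs to the class, so does $\mathrm{iCone}(i)\colon\mathrm{iCone}(E)\to\mathrm{iCone}(F)$. Then the model structure admits $\mathcal K$-enriched functorial factorizations. That is, let $\underline{\mathcal M}^{[1]}$ be the dg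 category of arrows, whose objects are the morphisms $f\colon A\to B$ of $\mathcal M$ and whose complex of morphisms from $f\colon A\to B$ to $f'\colon A'\to B'$ is $\underline{\mathcal M}(A,A')\times_{\underline{\mathcal M}(A,B')}\underline{\mathcal M}(B,B')$, and define the dg category $\underline{\mathcal M}^{[2]}$ of pairs of composable arrows similarly. Then there are two dg functors $\underline{\mathcal M}^{[1]}\to\underline{\mathcal M}^{[2]}$, $$(A\xrightarrow{f}B)\mapsto(A\xrightarrow{Lf}M(f)\xrightarrow{Rf}B)\quad\text{and}\quad(A\xrightarrow{f}B)\mapsto(A\xrightarrow{L'f}M'(f)\xrightarrow{R'f}B),$$ both sections of the composition dg functor $\underline{\mathcal M}^{[2]}\to\underline{\mathcal M}^{[1]}$, such that for every morphism $f$ of $\mathcal M$ the morphism $Lf$ is a cofibration, $Rf$ is a trivial fibration, $L'f$ is a trivial cofibration and $R'f$ is a fibration. -/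

import Mathlib

open CategoryTheory CategoryTheory.Limits HomotopicalAlgebra

universe v u u'

/-! # Differential graded categories -/

/-- A dg `k`-category with objects `M`, that is, a category enriched in the closed symmetric
monoidal category `C(k)` of cochain complexes of `k`-modules, spelled out on elements.
Composition is written in diagrammatic order: for `f : X ⟶ Y` of degree `p` and `g : Y ⟶ Z` of
degree `q`, `comp p q n h f g` is the morphism `g ∘ f` of degree `n = p + q`, and the Leibniz rule
is the usual one, `d (g ∘ f) = d g ∘ f + (-1)^{|g|} g ∘ d f`. -/
class DGCategory (k : Type v) [CommRing k] (M : Type u) where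
  /-- the complexes of morphisms -/
  homComplex : M → M → CochainComplex (ModuleCat.{v} k) ℤ
  /-- the identity morphisms -/
  id (X : M) : (homComplex X X).X 0
  /-- the composition, `k`-bilinear -/
  comp {X Y Z : M} (p q n : ℤ) (h : p + q = n) :
    (homComplex X Y).X p →ₗ[k] (homComplex Y Z).X q →ₗ[k] (homComplex X Z).X n
  d_id (X : M) : ((homComplex X X).d 0 1).hom (id X) = 0
  d_comp {X Y Z : M} (p q n : ℤ) (h : p + q = n) (f : (homComplex X Y).X p) (g : (homComplex Y Z).X q) :
    ((homComplex X Z).d n (n + 1)).hom (comp p q n h f g) =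
      comp p (q + 1) (n + 1) (by omega) f (((homComplex Y Z).d q (q + 1)).hom g) +
      q.negOnePow • comp (p + 1) q (n + 1) (by omega) (((homComplex X Y).d p (p + 1)).hom f) g
  id_comp {X Y : M} (p : ℤ) (f : (homComplex X Y).X p) : comp 0 p p (zero_add p) (id X) f = f
  comp_id {X Y : M} (p : ℤ) (f : (homComplex X Y).X p) : comp p 0 p (add_zero p) f (id Y) = f
  assoc {W X Y Z : M} (p q r pq qr n : ℤ) (hpq : p + q = pq) (hqr : q + r = qr)
    (h₁ : pq + r = n) (h₂ : p + qr = n)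
    (f : (homComplex W X).X p) (g : (homComplex X Y).X q) (l : (homComplex Y Z).X r) :
    comp pq r n h₁ (comp p q pq hpq f g) l = comp p qr n h₂ f (comp q r qr hqr g l)

/-- The complex of morphisms from `X` to `Y`. -/
abbrev DGCategory.hom (k : Type v) [CommRing k] {M : Type u} [DGCategory k M] (X Y : M) :
    CochainComplex (ModuleCat.{v} k) ℤ :=
  DGCategory.homComplex X Y

/-- A dg functor (`C(k)`-enriched functor) between dg `k`-categories. -/
structure DGFunctor (k : Type v) [CommRing k] (M : Type u) [DGCategory k M]
    (N : Type u') [DGCategory k N] where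
  obj : M → N
  map (X Y : M) : DGCategory.hom k X Y ⟶ DGCategory.hom k (obj X) (obj Y)
  map_id (X : M) : ((map X X).f 0).hom (DGCategory.id X) = DGCategory.id (obj X)
  map_comp {X Y Z : M} (p q n : ℤ) (h : p + q = n)
    (f : (DGCategory.hom k X Y).X p) (g : (DGCategory.hom k Y Z).X q) :
    ((map X Z).f n).hom (DGCategory.comp p q n h f g) =
      DGCategory.comp p q n h (((map X Y).f p).hom f) (((map Y Z).f q).hom g)

namespace DGCategory

variable {k : Type v} [CommRing k] {M : Type u} [DGCategory k M]

/-- The Leibniz rule with free indices. -/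
lemma d_comp' {X Y Z : M} (p q n p' q' n' : ℤ) (h : p + q = n) (hp : p + 1 = p') (hq : q + 1 = q')
    (hn : n + 1 = n') (f : (hom k X Y).X p) (g : (hom k Y Z).X q) :
    ((hom k X Z).d n n').hom (comp p q n h f g) =
      comp p q' n' (by omega) f (((hom k Y Z).d q q').hom g) +
      q.negOnePow • comp p' q n' (by omega) (((hom k X Y).d p p').hom f) g := by
  subst hp hq hn
  exact d_comp p q n h f g

end DGCategory

/-! # The underlying category -/

namespace DGCategory

/-- The type of objects of the underlying ordinary category of a dg `k`-category `M`. -/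
@[ext]
structure Underlying (k : Type v) [CommRing k] (M : Type u) [DGCategory k M] : Type u where
  of ::
  /-- the object of `M` -/
  as : M

section

variable {k : Type v} [CommRing k] {M : Type u} [DGCategory k M]

variable (k) in
/-- Closed morphisms of degree zero. -/
@[ext]
structure ClosedHom (X Y : M) : Type v where
  val : (hom k X Y).X 0
  closed : ((hom k X Y).d 0 1).hom val = 0

variable (k) in
/-- The identity as a closed morphism of degree zero. -/
def ClosedHom.id (X : M) : ClosedHom k X X := ⟨DGCategory.id X, d_id X⟩

/-- Composition of closed morphisms of degree zero, in diagrammatic order. -/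
def ClosedHom.comp {X Y Z : M} (f : ClosedHom k X Y) (g : ClosedHom k Y Z) : ClosedHom k X Z where
  val := DGCategory.comp 0 0 0 (zero_add 0) f.val g.val
  closed := by
    rw [d_comp' 0 0 0 1 1 1 (zero_add 0) (zero_add 1) (zero_add 1) (zero_add 1), f.closed,
      g.closed]
    simp

/-- The underlying category of a dg category: its morphisms are the closed morphisms of degree
zero. -/
instance : Category.{v} (Underlying k M) where
  Hom X Y := ClosedHom k X.as Y.as
  id X := ClosedHom.id k X.as
  comp f g := ClosedHom.comp f g
  id_comp f := ClosedHom.ext (DGCategory.id_comp 0 f.val)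
  comp_id f := ClosedHom.ext (DGCategory.comp_id 0 f.val)
  assoc f g h := ClosedHom.ext (DGCategory.assoc 0 0 0 0 0 0 (zero_add 0) (zero_add 0)
    (zero_add 0) (zero_add 0) f.val g.val h.val)

@[ext]
lemma Underlying.hom_ext {X Y : Underlying k M} {f g : X ⟶ Y}
    (h : ClosedHom.val f = ClosedHom.val g) : f = g := ClosedHom.ext h

@[simp]
lemma Underlying.comp_val {X Y Z : Underlying k M} (f : X ⟶ Y) (g : Y ⟶ Z) :
    ClosedHom.val (f ≫ g) = DGCategory.comp 0 0 0 (zero_add 0) (ClosedHom.val f)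
      (ClosedHom.val g) := rfl

@[simp]
lemma Underlying.id_val (X : Underlying k M) :
    ClosedHom.val (𝟙 X) = DGCategory.id X.as := rfl

end

end DGCategory

/-! # Right dg modules -/

/-- A right dg module over a dg `k`-category `M`, that is, a dg functor from `Mᵒᵖ` to the dg
category of complexes of `k`-modules, written as a right action: `act p q n h a y` is `y · a`, and
`d (y · a) = d y · a + (-1)^{|y|} y · d a`. -/
structure DGModule (k : Type v) [CommRing k] (M : Type u) [DGCategory k M] where
  obj : M → CochainComplex (ModuleCat.{v} k) ℤ
  act {X Y : M} (p q n : ℤ) (h : p + q = n) :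
    (DGCategory.hom k X Y).X p →ₗ[k] (obj Y).X q →ₗ[k] (obj X).X n
  d_act {X Y : M} (p q n : ℤ) (h : p + q = n)
    (a : (DGCategory.hom k X Y).X p) (y : (obj Y).X q) :
    ((obj X).d n (n + 1)).hom (act p q n h a y) =
      act p (q + 1) (n + 1) (by omega) a (((obj Y).d q (q + 1)).hom y) +
      q.negOnePow • act (p + 1) q (n + 1) (by omega)
        (((DGCategory.hom k X Y).d p (p + 1)).hom a) y
  id_act {X : M} (q : ℤ) (y : (obj X).X q) : act 0 q q (zero_add q) (DGCategory.id X) y = y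
  comp_act {X Y Z : M} (p q r pq qr n : ℤ) (hpq : p + q = pq) (hqr : q + r = qr)
    (h₁ : pq + r = n) (h₂ : p + qr = n)
    (a : (DGCategory.hom k X Y).X p) (b : (DGCategory.hom k Y Z).X q) (z : (obj Z).X r) :
    act pq r n h₁ (DGCategory.comp p q pq hpq a b) z = act p qr n h₂ a (act q r qr hqr b z)

namespace DGModule

variable {k : Type v} [CommRing k] {M : Type u} [DGCategory k M]

/-- Morphisms of dg modules: closed dg natural transformations of degree zero. -/
@[ext]
structure Hom (P Q : DGModule k M) where
  app (X : M) : P.obj X ⟶ Q.obj X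
  app_act {X Y : M} (p q n : ℤ) (h : p + q = n)
    (a : (DGCategory.hom k X Y).X p) (y : (P.obj Y).X q) :
    ((app X).f n).hom (P.act p q n h a y) = Q.act p q n h a (((app Y).f q).hom y)

instance : Category (DGModule k M) where
  Hom := Hom
  id P := ⟨fun _ => 𝟙 _, by intros; rfl⟩
  comp α β := ⟨fun X => α.app X ≫ β.app X, by
    intro X Y p q n h a y
    simp [α.app_act, β.app_act]⟩

@[ext]
lemma hom_ext {P Q : DGModule k M} {α β : P ⟶ Q} (h : ∀ X, α.app X = β.app X) : α = β :=
  Hom.ext (funext h)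

@[simp]
lemma id_app (P : DGModule k M) (X : M) : Hom.app (𝟙 P) X = 𝟙 (P.obj X) := rfl

@[simp]
lemma comp_app {P Q R : DGModule k M} (α : P ⟶ Q) (β : Q ⟶ R) (X : M) :
    (α ≫ β).app X = α.app X ≫ β.app X := rfl

/-- The Leibniz rule with free indices. -/
lemma d_act' (P : DGModule k M) {X Y : M} (p q n p' q' n' : ℤ) (h : p + q = n) (hp : p + 1 = p')
    (hq : q + 1 = q') (hn : n + 1 = n') (a : (DGCategory.hom k X Y).X p) (y : (P.obj Y).X q) :
    ((P.obj X).d n n').hom (P.act p q n h a y) =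
      P.act p q' n' (by omega) a (((P.obj Y).d q q').hom y) +
      q.negOnePow • P.act p' q n' (by omega) (((DGCategory.hom k X Y).d p p').hom a) y := by
  subst hp hq hn
  exact P.d_act p q n h a y

variable (k M) in
/-- The zero module. -/
def zero : DGModule k M where
  obj _ := { X := fun _ => ModuleCat.of k PUnit, d := fun _ _ => 0 }
  act _ _ _ _ := 0
  d_act _ _ _ _ _ _ := rfl
  id_act _ _ := rfl
  comp_act _ _ _ _ _ _ _ _ _ _ _ _ _ := rfl

/-- The dg module `[m] P`, with `([m] P)(X) = P(X)[m]`: its component of degree `q` is the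
component of `P(X)` of degree `q + m`, its differential is that of `P(X)` multiplied by `(-1)^m`,
and the right action is unchanged. -/
noncomputable def shiftObj (m : ℤ) (P : DGModule k M) : DGModule k M where
  obj X := (P.obj X)⟦m⟧
  act p q n h := P.act p (q + m) (n + m) (by omega)
  d_act {X Y} p q n h a y := by
    have main : ∀ y : (P.obj Y).X (q + m),
        m.negOnePow • ((P.obj X).d (n + m) (n + 1 + m)).hom
            (P.act p (q + m) (n + m) (by omega) a y) =
          P.act p (q + 1 + m) (n + 1 + m) (by omega) a
            (m.negOnePow • ((P.obj Y).d (q + m) (q + 1 + m)).hom y) +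
          q.negOnePow • P.act (p + 1) (q + m) (n + 1 + m) (by omega)
            (((DGCategory.hom k X Y).d p (p + 1)).hom a) y := by
      intro y
      have hs : m.negOnePow * (q + m).negOnePow = q.negOnePow := by
        rw [← Int.negOnePow_add, show m + (q + m) = q + (m + m) by ring, Int.negOnePow_add,
          Int.negOnePow_even (m + m) ⟨m, rfl⟩, mul_one]
      rw [P.d_act' p (q + m) (n + m) (p + 1) (q + 1 + m) (n + 1 + m) (by omega) rfl
        (by omega) (by omega) a y, smul_add, smul_smul, hs, LinearMap.map_smul_of_tower]
    exact main y
  id_act q y := P.id_act (q + m) y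
  comp_act p q r pq qr n hpq hqr h₁ h₂ a b z :=
    P.comp_act p q (r + m) pq (qr + m) (n + m) hpq (by omega) (by omega) (by omega) a b z

/-- The shift functor `[m]` on dg modules. -/
noncomputable def shift (m : ℤ) : DGModule k M ⥤ DGModule k M where
  obj P := shiftObj m P
  map {P Q} α :=
    { app := fun X => (shiftFunctor (CochainComplex (ModuleCat.{v} k) ℤ) m).map (α.app X)
      app_act := fun p q n h a y => α.app_act p (q + m) (n + m) (by omega) a y }
  map_id P := by ext X : 1; exact (shiftFunctor _ m).map_id (P.obj X)
  map_comp α β := by ext X : 1; exact (shiftFunctor _ m).map_comp (α.app X) (β.app X)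

/-- The cone of a morphism of complexes `φ : K ⟶ L`: the graded module `L ⊕ K[1]` with
differential `(y, x) ↦ (d y + φ x, - d x)`. -/
noncomputable def coneComplex {K L : CochainComplex (ModuleCat.{v} k) ℤ} (φ : K ⟶ L) :
    CochainComplex (ModuleCat.{v} k) ℤ :=
  CochainComplex.of (fun n => ModuleCat.of k (L.X n × K.X (n + 1)))
    (fun n => ModuleCat.ofHom
      (((L.d n (n + 1)).hom.comp (LinearMap.fst k _ _) +
          (φ.f (n + 1)).hom.comp (LinearMap.snd k _ _)).prod
        (-((K.d (n + 1) (n + 1 + 1)).hom.comp (LinearMap.snd k _ _)))))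
    (fun n => by
      have h₁ : L.d n (n + 1) ≫ L.d (n + 1) (n + 1 + 1) = 0 := L.d_comp_d _ _ _
      have h₂ : K.d (n + 1) (n + 1 + 1) ≫ K.d (n + 1 + 1) (n + 1 + 1 + 1) = 0 := K.d_comp_d _ _ _
      have h₃ := φ.comm (n + 1) (n + 1 + 1)
      apply ModuleCat.hom_ext
      refine LinearMap.ext fun z => Prod.ext ?_ ?_
      · have e₁ := LinearMap.congr_fun (congrArg ModuleCat.Hom.hom h₁) z.1
        have e₃ := LinearMap.congr_fun (congrArg ModuleCat.Hom.hom h₃) z.2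
        change (L.d (n + 1) (n + 1 + 1)).hom ((L.d n (n + 1)).hom z.1) = 0 at e₁
        change (L.d (n + 1) (n + 1 + 1)).hom ((φ.f (n + 1)).hom z.2) =
          (φ.f (n + 1 + 1)).hom ((K.d (n + 1) (n + 1 + 1)).hom z.2) at e₃
        change (L.d (n + 1) (n + 1 + 1)).hom ((L.d n (n + 1)).hom z.1 + (φ.f (n + 1)).hom z.2) +
          (φ.f (n + 1 + 1)).hom (-(K.d (n + 1) (n + 1 + 1)).hom z.2) = 0
        rw [map_add, e₁, e₃, map_neg, zero_add, add_neg_cancel]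
      · have e₂ := LinearMap.congr_fun (congrArg ModuleCat.Hom.hom h₂) z.2
        change (K.d (n + 1 + 1) (n + 1 + 1 + 1)).hom ((K.d (n + 1) (n + 1 + 1)).hom z.2) = 0 at e₂
        change -(K.d (n + 1 + 1) (n + 1 + 1 + 1)).hom (-(K.d (n + 1) (n + 1 + 1)).hom z.2) = 0
        rw [map_neg, e₂, neg_zero, neg_zero])

lemma coneComplex_d_apply {K L : CochainComplex (ModuleCat.{v} k) ℤ} (φ : K ⟶ L) (n : ℤ)
    (z : L.X n × K.X (n + 1)) :
    ((coneComplex φ).d n (n + 1)).hom z =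
      (((L.d n (n + 1)).hom z.1 + (φ.f (n + 1)).hom z.2, -(K.d (n + 1) (n + 1 + 1)).hom z.2) :
        L.X (n + 1) × K.X (n + 1 + 1)) := by
  exact LinearMap.congr_fun (congrArg ModuleCat.Hom.hom (CochainComplex.of_d
    (fun n => ModuleCat.of k (L.X n × K.X (n + 1))) _ n)) z

/-- The dg module `Cone α` for a morphism `α : P ⟶ Q` of dg modules, with
`(Cone α)(X) = Cone (α_X : P(X) ⟶ Q(X))` and componentwise right action. -/
noncomputable def coneObj {P Q : DGModule k M} (α : P ⟶ Q) : DGModule k M where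
  obj X := coneComplex (α.app X)
  act {X Y} p q n h := LinearMap.mk₂ k
    (fun (a : (DGCategory.hom k X Y).X p) (z : (Q.obj Y).X q × (P.obj Y).X (q + 1)) =>
      ((Q.act p q n h a z.1, P.act p (q + 1) (n + 1) (by omega) a z.2) :
        (Q.obj X).X n × (P.obj X).X (n + 1)))
    (fun a a' z => Prod.ext (LinearMap.map_add₂ _ a a' z.1) (LinearMap.map_add₂ _ a a' z.2))
    (fun c a z => Prod.ext (LinearMap.map_smul₂ _ c a z.1) (LinearMap.map_smul₂ _ c a z.2))
    (fun a z z' => Prod.ext (map_add (Q.act p q n h a) z.1 z'.1)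
      (map_add (P.act p (q + 1) (n + 1) (by omega) a) z.2 z'.2))
    (fun c a z => Prod.ext (map_smul (Q.act p q n h a) c z.1)
      (map_smul (P.act p (q + 1) (n + 1) (by omega) a) c z.2))
  d_act {X Y} p q n h a y := by
    have hy := coneComplex_d_apply (α.app Y) q y
    refine (coneComplex_d_apply (α.app X) n _).trans ?_
    rw [hy]
    have main₁ : ∀ (y₁ : (Q.obj Y).X q) (y₂ : (P.obj Y).X (q + 1)),
        ((Q.obj X).d n (n + 1)).hom (Q.act p q n h a y₁) +
            ((α.app X).f (n + 1)).hom (P.act p (q + 1) (n + 1) (by omega) a y₂) =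
          Q.act p (q + 1) (n + 1) (by omega) a
            (((Q.obj Y).d q (q + 1)).hom y₁ + ((α.app Y).f (q + 1)).hom y₂) +
          q.negOnePow • Q.act (p + 1) q (n + 1) (by omega)
            (((DGCategory.hom k X Y).d p (p + 1)).hom a) y₁ := by
      intro y₁ y₂
      rw [Q.d_act, α.app_act, map_add]
      abel
    have main₂ : ∀ (y₂ : (P.obj Y).X (q + 1)),
        -((P.obj X).d (n + 1) (n + 1 + 1)).hom (P.act p (q + 1) (n + 1) (by omega) a y₂) =
          P.act p (q + 1 + 1) (n + 1 + 1) (by omega) a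
            (-((P.obj Y).d (q + 1) (q + 1 + 1)).hom y₂) +
          q.negOnePow • P.act (p + 1) (q + 1) (n + 1 + 1) (by omega)
            (((DGCategory.hom k X Y).d p (p + 1)).hom a) y₂ := by
      intro y₂
      rw [P.d_act, map_neg, Int.negOnePow_succ, Units.neg_smul, neg_add, neg_neg]
    exact Prod.ext (main₁ y.1 y.2) (main₂ y.2)
  id_act q y := Prod.ext (Q.id_act q y.1) (P.id_act (q + 1) y.2)
  comp_act p q r pq qr n hpq hqr h₁ h₂ a b z := Prod.ext
    (Q.comp_act p q r pq qr n hpq hqr h₁ h₂ a b z.1)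
    (P.comp_act p q (r + 1) pq (qr + 1) (n + 1) hpq (by omega) (by omega) (by omega) a b z.2)

/-- The morphism of cones induced by a commutative square of complexes. -/
noncomputable def coneComplexMap {K L K' L' : CochainComplex (ModuleCat.{v} k) ℤ} (φ : K ⟶ L)
    (φ' : K' ⟶ L') (a : K ⟶ K') (b : L ⟶ L') (h : a ≫ φ' = φ ≫ b) :
    coneComplex φ ⟶ coneComplex φ' where
  f n := ModuleCat.ofHom ((b.f n).hom.prodMap (a.f (n + 1)).hom)
  comm' i j hij := by
    obtain rfl : i + 1 = j := hij
    apply ModuleCat.hom_ext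
    refine LinearMap.ext fun z => ?_
    have main₁ : ∀ (y : L.X i) (x : K.X (i + 1)),
        (L'.d i (i + 1)).hom ((b.f i).hom y) + (φ'.f (i + 1)).hom ((a.f (i + 1)).hom x) =
          (b.f (i + 1)).hom ((L.d i (i + 1)).hom y + (φ.f (i + 1)).hom x) := by
      intro y x
      have e₁ := LinearMap.congr_fun (congrArg ModuleCat.Hom.hom (b.comm i (i + 1))) y
      have e₂ := LinearMap.congr_fun (congrArg (fun t => ModuleCat.Hom.hom
        (HomologicalComplex.Hom.f t (i + 1))) h) x
      rw [map_add]
      exact congrArg₂ (· + ·) e₁ e₂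
    have main₂ : ∀ (x : K.X (i + 1)),
        -(K'.d (i + 1) (i + 1 + 1)).hom ((a.f (i + 1)).hom x) =
          (a.f (i + 1 + 1)).hom (-(K.d (i + 1) (i + 1 + 1)).hom x) := by
      intro x
      have e := LinearMap.congr_fun (congrArg ModuleCat.Hom.hom (a.comm (i + 1) (i + 1 + 1))) x
      rw [map_neg]
      exact congrArg (- ·) e
    have e := coneComplex_d_apply φ i z
    refine (coneComplex_d_apply φ' i _).trans (Eq.trans ?_
      (congrArg (ModuleCat.ofHom ((b.f (i + 1)).hom.prodMap (a.f (i + 1 + 1)).hom)).hom e).symm)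
    exact Prod.ext (main₁ z.1 z.2) (main₂ z.2)

/-- The cone functor on morphisms of dg modules. -/
noncomputable def cone : Arrow (DGModule k M) ⥤ DGModule k M where
  obj α := coneObj α.hom
  map {α β} sq :=
    { app := fun X => coneComplexMap _ _ (Hom.app sq.left X) (Hom.app sq.right X)
        (by rw [← comp_app, ← comp_app, Arrow.w])
      app_act := fun p q n h a y => Prod.ext (sq.right.app_act p q n h a y.1)
        (sq.left.app_act p (q + 1) (n + 1) (by omega) a y.2) }
  map_id _ := rfl
  map_comp _ _ := rfl

/-- The dg module `Yo(Z) = M(-, Z)` represented by `Z`; the action is precomposition. -/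
def yonedaObj (k : Type v) [CommRing k] {M : Type u} [DGCategory k M] (Z : M) : DGModule k M where
  obj X := DGCategory.hom k X Z
  act p q n h := DGCategory.comp p q n h
  d_act p q n h a y := DGCategory.d_comp p q n h a y
  id_act q y := DGCategory.id_comp q y
  comp_act p q r pq qr n hpq hqr h₁ h₂ a b z := DGCategory.assoc p q r pq qr n hpq hqr h₁ h₂ a b z

/-- Postcomposition with a closed morphism of degree zero. -/
noncomputable def yonedaMap {Z Z' : M} (f : DGCategory.ClosedHom k Z Z') :
    yonedaObj k Z ⟶ yonedaObj k Z' where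
  app X :=
    { f := fun n => ModuleCat.ofHom ((DGCategory.comp n 0 n (add_zero n)).flip f.val)
      comm' := by
        intro i j hij
        obtain rfl : i + 1 = j := hij
        apply ModuleCat.hom_ext
        refine LinearMap.ext fun z => ?_
        refine (DGCategory.d_comp' i 0 i (i + 1) 1 (i + 1) (add_zero i) rfl (zero_add 1) rfl z
          f.val).trans ?_
        rw [f.closed, map_zero, zero_add, Int.negOnePow_zero, one_smul]
        rfl }
  app_act p q n h a y := DGCategory.assoc p q 0 n q n h (add_zero q) (add_zero n) h a y f.val

variable (k M) in
/-- The Yoneda functor from the underlying category to dg modules. -/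
noncomputable def yoneda : DGCategory.Underlying k M ⥤ DGModule k M where
  obj Z := yonedaObj k Z.as
  map f := yonedaMap f
  map_id Z := by
    refine hom_ext fun X => HomologicalComplex.hom_ext _ _ fun n => ModuleCat.hom_ext ?_
    exact LinearMap.ext fun z => DGCategory.comp_id n z
  map_comp f g := by
    refine hom_ext fun X => HomologicalComplex.hom_ext _ _ fun n => ModuleCat.hom_ext ?_
    exact LinearMap.ext fun z => (DGCategory.assoc n 0 0 n 0 n (add_zero n) (add_zero 0)
      (add_zero n) (add_zero n) z (DGCategory.ClosedHom.val f) (DGCategory.ClosedHom.val g)).symm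

/-- The Yoneda lemma: the Yoneda functor is fully faithful. -/
noncomputable def yonedaFullyFaithful : (yoneda k M).FullyFaithful where
  preimage {Y Z} α :=
    { val := ((Hom.app α Y.as).f 0).hom (DGCategory.id Y.as)
      closed := by
        have e := LinearMap.congr_fun (congrArg ModuleCat.Hom.hom ((Hom.app α Y.as).comm 0 1))
          (DGCategory.id Y.as)
        refine e.trans ?_
        refine Eq.trans (congrArg ((Hom.app α Y.as).f 1).hom (DGCategory.d_id Y.as)) ?_
        exact map_zero ((Hom.app α Y.as).f 1).hom }
  map_preimage {Y Z} α := by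
    refine hom_ext fun X => HomologicalComplex.hom_ext _ _ fun n => ModuleCat.hom_ext ?_
    refine LinearMap.ext fun z => ?_
    refine (Hom.app_act α n 0 n (add_zero n) z (DGCategory.id Y.as)).symm.trans ?_
    exact congrArg ((Hom.app α X).f n).hom (DGCategory.comp_id n z)
  preimage_map {Y Z} f := DGCategory.ClosedHom.ext (DGCategory.id_comp 0 _)

instance : (yoneda k M).Full := yonedaFullyFaithful.full

instance : (yoneda k M).Faithful := yonedaFullyFaithful.faithful

end DGModule

namespace DGCategory

/-! # Strongly pretriangulated dg categories, shift and identity cone -/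

variable (k : Type v) [CommRing k] (M : Type u) [DGCategory k M]

/-- A dg category is strongly pretriangulated if the zero module, the shifts of representable
modules and the cones of morphisms between representable modules are representable. -/
structure IsStronglyPretriangulated : Prop where
  zero : (DGModule.yoneda k M).essImage (DGModule.zero k M)
  shift (n : ℤ) (X : Underlying k M) :
    (DGModule.yoneda k M).essImage ((DGModule.shift n).obj ((DGModule.yoneda k M).obj X))
  cone (f : Arrow (Underlying k M)) :
    (DGModule.yoneda k M).essImage (DGModule.cone.obj ((DGModule.yoneda k M).mapArrow.obj f))

variable {k M}

namespace IsStronglyPretriangulated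

variable (hM : IsStronglyPretriangulated k M)

/-- The shift functor `[n]` on the underlying category, with `Yo ∘ [n] ≅ [n] ∘ Yo`. -/
noncomputable def shiftFunctor (n : ℤ) : Underlying k M ⥤ Underlying k M :=
  Functor.essImage.liftFunctor (DGModule.yoneda k M ⋙ DGModule.shift n) (DGModule.yoneda k M)
    (hM.shift n)

/-- The cone functor, with `Yo ∘ Cone ≅ Cone ∘ Yo`. -/
noncomputable def coneFunctor : Arrow (Underlying k M) ⥤ Underlying k M :=
  Functor.essImage.liftFunctor ((DGModule.yoneda k M).mapArrow ⋙ DGModule.cone)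
    (DGModule.yoneda k M) hM.cone

/-- The identity cone functor `X ↦ Cone (𝟙 X)`, `f ↦ Cone (f, f)`. -/
noncomputable def iCone : Underlying k M ⥤ Underlying k M :=
  { obj := fun X => Arrow.mk (𝟙 X)
    map := fun f => Arrow.homMk f f : Underlying k M ⥤ Arrow (Underlying k M) } ⋙ hM.coneFunctor

end IsStronglyPretriangulated

/-! # Tensors, cotensors and bicompleteness -/

section

open CochainComplex.HomComplex

variable {K : CochainComplex (ModuleCat.{v} k) ℤ}

/-- For a closed degree zero map `η : K ⟶ M(X, P)`, the component of degree `n` of the map of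
complexes `M(P, N) ⟶ Hom(K, M(X, N))`, `g ↦ (x ↦ g ∘ η x)`. -/
noncomputable def tensorComparison {X P : M} (η : K ⟶ hom k X P) (N : M) (n : ℤ)
    (g : (hom k P N).X n) : Cochain K (hom k X N) n :=
  Cochain.mk fun p q hpq => ModuleCat.ofHom (((comp p n q hpq).flip g).comp (η.f p).hom)

/-- For a closed degree zero map `ε : K ⟶ M(Q, N)`, the component of degree `n` of the map of
complexes `M(X, Q) ⟶ Hom(K, M(X, N))`, `f ↦ (x ↦ (-1)^{|f||x|} ε x ∘ f)`. -/
noncomputable def cotensorComparison {Q N : M} (ε : K ⟶ hom k Q N) (X : M) (n : ℤ)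
    (f : (hom k X Q).X n) : Cochain K (hom k X N) n :=
  Cochain.mk fun p q hpq => ModuleCat.ofHom
    ((n * p).negOnePow • (comp n p q (by omega) f).comp (ε.f p).hom)

variable (k M)

/-- A dg category is tensored if for all complexes `K` and objects `X` there are an object
`P = X ⊙ K` and isomorphisms of complexes `M(P, N) ≅ Hom(K, M(X, N))`, dg natural in `N`
(hence given by composition with a map `η : K ⟶ M(X, P)`). -/
def IsTensored : Prop :=
  ∀ (K : CochainComplex (ModuleCat.{v} k) ℤ) (X : M), ∃ (P : M) (η : K ⟶ hom k X P),
    ∀ (N : M) (n : ℤ), Function.Bijective (tensorComparison η N n)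

/-- A dg category is cotensored if for all complexes `K` and objects `N` there are an object
`Q = Ψ(K, N)` and isomorphisms of complexes `M(X, Q) ≅ Hom(K, M(X, N))`, dg natural in `X`
(hence given by composition with a map `ε : K ⟶ M(Q, N)`). -/
def IsCotensored : Prop :=
  ∀ (K : CochainComplex (ModuleCat.{v} k) ℤ) (N : M), ∃ (Q : M) (ε : K ⟶ hom k Q N),
    ∀ (X : M) (n : ℤ), Function.Bijective (cotensorComparison ε X n)

/-- A dg `k`-category is `C(k)`-bicomplete if it is tensored and cotensored and its underlying
category has all small limits and colimits. -/
structure IsBicomplete : Prop where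
  tensored : IsTensored k M
  cotensored : IsCotensored k M
  hasLimits : HasLimits (Underlying k M)
  hasColimits : HasColimits (Underlying k M)

end

/-! # The dg category of arrows and enriched functorial factorizations -/

/-- The degree `n` part of the morphisms in the dg category of arrows: pairs `(a, b)` making the
square commute. -/
def arrowHom {k : Type v} [CommRing k] {M : Type u} [DGCategory k M]
    (f g : Arrow (Underlying k M)) (n : ℤ) :
    Submodule k ((hom k f.left.as g.left.as).X n × (hom k f.right.as g.right.as).X n) :=
  LinearMap.eqLocus
    ((comp 0 n n (zero_add n) (ClosedHom.val f.hom)).comp (LinearMap.snd k _ _))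
    (((comp n 0 n (add_zero n)).flip (ClosedHom.val g.hom)).comp (LinearMap.fst k _ _))

/-- The complex of morphisms in the dg category of arrows. -/
def arrowHomComplex {k : Type v} [CommRing k] {M : Type u} [DGCategory k M]
    (f g : Arrow (Underlying k M)) : CochainComplex (ModuleCat.{v} k) ℤ where
  X n := ModuleCat.of k (arrowHom f g n)
  d i j := ModuleCat.ofHom
    ((((hom k f.left.as g.left.as).d i j).hom.prodMap
      ((hom k f.right.as g.right.as).d i j).hom).restrict (by
        rintro ⟨a, b⟩ (h : comp 0 i i (zero_add i) (ClosedHom.val f.hom) b =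
          comp i 0 i (add_zero i) a (ClosedHom.val g.hom))
        change comp 0 j j (zero_add j) (ClosedHom.val f.hom) (((hom k _ _).d i j).hom b) =
          comp j 0 j (add_zero j) (((hom k _ _).d i j).hom a) (ClosedHom.val g.hom)
        by_cases hij : i + 1 = j
        · have e := congrArg ((hom k f.left.as g.right.as).d i j).hom h
          rw [d_comp' 0 i i 1 j j (zero_add i) (zero_add 1) hij hij, f.hom.closed,
            d_comp' i 0 i j 1 j (add_zero i) hij (zero_add 1) hij, g.hom.closed] at e
          simpa using e
        · rw [(hom k f.left.as g.left.as).shape i j hij,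
            (hom k f.right.as g.right.as).shape i j hij]
          simp))
  shape i j hij := by
    apply ModuleCat.hom_ext
    refine LinearMap.ext fun z => Subtype.ext (Prod.ext ?_ ?_)
    · exact LinearMap.congr_fun (congrArg ModuleCat.Hom.hom
        ((hom k f.left.as g.left.as).shape i j hij)) z.1.1
    · exact LinearMap.congr_fun (congrArg ModuleCat.Hom.hom
        ((hom k f.right.as g.right.as).shape i j hij)) z.1.2
  d_comp_d' i j l _ _ := by
    apply ModuleCat.hom_ext
    refine LinearMap.ext fun z => Subtype.ext (Prod.ext ?_ ?_)
    · exact LinearMap.congr_fun (congrArg ModuleCat.Hom.hom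
        ((hom k f.left.as g.left.as).d_comp_d i j l)) z.1.1
    · exact LinearMap.congr_fun (congrArg ModuleCat.Hom.hom
        ((hom k f.right.as g.right.as).d_comp_d i j l)) z.1.2

/-- The dg category of arrows: its objects are the morphisms of the underlying category (closed of
degree zero), and its complexes of morphisms consist of the pairs `(a, b)` making the square
commute. -/
instance instArrow {k : Type v} [CommRing k] {M : Type u} [DGCategory k M] :
    DGCategory k (Arrow (Underlying k M)) where
  homComplex := arrowHomComplex
  id f := ⟨(DGCategory.id f.left.as, DGCategory.id f.right.as),
    (DGCategory.comp_id 0 (ClosedHom.val f.hom)).trans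
      (DGCategory.id_comp 0 (ClosedHom.val f.hom)).symm⟩
  comp {f g l} p q n h := LinearMap.mk₂ k
    (fun (s : arrowHom f g p) (t : arrowHom g l q) =>
      (⟨(DGCategory.comp p q n h s.1.1 t.1.1, DGCategory.comp p q n h s.1.2 t.1.2), by
        have hs : DGCategory.comp 0 p p (zero_add p) (ClosedHom.val f.hom) s.1.2 =
          DGCategory.comp p 0 p (add_zero p) s.1.1 (ClosedHom.val g.hom) := s.2
        have ht : DGCategory.comp 0 q q (zero_add q) (ClosedHom.val g.hom) t.1.2 =
          DGCategory.comp q 0 q (add_zero q) t.1.1 (ClosedHom.val l.hom) := t.2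
        change DGCategory.comp 0 n n (zero_add n) (ClosedHom.val f.hom)
            (DGCategory.comp p q n h s.1.2 t.1.2) =
          DGCategory.comp n 0 n (add_zero n) (DGCategory.comp p q n h s.1.1 t.1.1)
            (ClosedHom.val l.hom)
        rw [← DGCategory.assoc 0 p q p n n (zero_add p) h h (zero_add n), hs,
          DGCategory.assoc p 0 q p q n (add_zero p) (zero_add q) h h, ht,
          DGCategory.assoc p q 0 n q n h (add_zero q) (add_zero n) h]⟩ : arrowHom f l n))
    (fun s s' t => Subtype.ext (Prod.ext (LinearMap.map_add₂ _ _ _ _)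
      (LinearMap.map_add₂ _ _ _ _)))
    (fun c s t => Subtype.ext (Prod.ext (LinearMap.map_smul₂ _ _ _ _)
      (LinearMap.map_smul₂ _ _ _ _)))
    (fun s t t' => Subtype.ext (Prod.ext (map_add (DGCategory.comp p q n h s.1.1) _ _)
      (map_add (DGCategory.comp p q n h s.1.2) _ _)))
    (fun c s t => Subtype.ext (Prod.ext (map_smul (DGCategory.comp p q n h s.1.1) _ _)
      (map_smul (DGCategory.comp p q n h s.1.2) _ _)))
  d_id f := Subtype.ext (Prod.ext (d_id f.left.as) (d_id f.right.as))
  d_comp p q n h s t := Subtype.ext (Prod.ext (d_comp p q n h s.1.1 t.1.1)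
    (d_comp p q n h s.1.2 t.1.2))
  id_comp p s := Subtype.ext (Prod.ext (DGCategory.id_comp p s.1.1) (DGCategory.id_comp p s.1.2))
  comp_id p s := Subtype.ext (Prod.ext (DGCategory.comp_id p s.1.1) (DGCategory.comp_id p s.1.2))
  assoc p q r pq qr n hpq hqr h₁ h₂ s t w := Subtype.ext (Prod.ext
    (DGCategory.assoc p q r pq qr n hpq hqr h₁ h₂ s.1.1 t.1.1 w.1.1)
    (DGCategory.assoc p q r pq qr n hpq hqr h₁ h₂ s.1.2 t.1.2 w.1.2))

variable (k M) in
/-- A `C(k)`-enriched functorial factorization: a section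
`(f : A ⟶ B) ↦ (A ⟶ mid f ⟶ B)`, `(a, b) ↦ (a, mid (a, b), b)` of the composition dg functor from
the dg category of pairs of composable arrows to the dg category of arrows. That is, a dg functor
`mid` from the dg category of arrows to `M` and closed morphisms `L f`, `R f` of degree zero
composing to `f`, such that `(a, mid (a, b), b)` is a morphism of composable pairs of arrows for
every morphism `(a, b)` of arrows of any degree. -/
structure EnrichedFactorization where
  mid : DGFunctor k (Arrow (Underlying k M)) M
  L (f : Arrow (Underlying k M)) : f.left ⟶ Underlying.of (mid.obj f)
  R (f : Arrow (Underlying k M)) : Underlying.of (mid.obj f) ⟶ f.right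
  fac (f : Arrow (Underlying k M)) : L f ≫ R f = f.hom
  L_naturality (f g : Arrow (Underlying k M)) (n : ℤ) (s : arrowHom f g n) :
    DGCategory.comp 0 n n (zero_add n) (ClosedHom.val (L f)) (((mid.map f g).f n).hom s) =
      DGCategory.comp n 0 n (add_zero n) s.1.1 (ClosedHom.val (L g))
  R_naturality (f g : Arrow (Underlying k M)) (n : ℤ) (s : arrowHom f g n) :
    DGCategory.comp 0 n n (zero_add n) (ClosedHom.val (R f)) s.1.2 =
      DGCategory.comp n 0 n (add_zero n) (((mid.map f g).f n).hom s) (ClosedHom.val (R g))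

variable (k M) in
/-- The model structure on the underlying category admits `C(k)`-enriched functorial
factorizations, into a cofibration followed by a trivial fibration and into a trivial cofibration
followed by a fibration. -/
def AdmitsEnrichedFactorizations [ModelCategory (Underlying k M)] : Prop :=
  (∃ F : EnrichedFactorization k M, ∀ f : Arrow (Underlying k M),
    cofibrations (Underlying k M) (F.L f) ∧ trivialFibrations (Underlying k M) (F.R f)) ∧
  (∃ F : EnrichedFactorization k M, ∀ f : Arrow (Underlying k M),
    trivialCofibrations (Underlying k M) (F.L f) ∧ fibrations (Underlying k M) (F.R f))

end DGCategory

/-! # Cofibrantly generated model categories -/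

section

variable {C : Type u} [Category.{v} C]

/-- The relative `I`-cell complexes: transfinite compositions of pushouts of coproducts of
morphisms in `I`. -/
def relativeCellComplexes (I : MorphismProperty C) : MorphismProperty C :=
  MorphismProperty.transfiniteCompositions.{v} (MorphismProperty.coproducts.{v} I).pushouts

/-- The object `A` is small relative to the class `W`: there is a cardinal `κ` such that for every
regular cardinal `μ ≥ κ`, the functor `Hom(A, -)` preserves the colimits of all `μ`-sequences
whose successive maps belong to `W`. -/
def IsSmallRelativeTo (W : MorphismProperty C) (A : C) : Prop :=
  ∃ κ : Cardinal.{v}, ∀ μ : Cardinal.{v}, κ ≤ μ → μ.IsRegular →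
    ∀ F : μ.ord.ToType ⥤ C, F.IsWellOrderContinuous →
      (∀ j : μ.ord.ToType, ¬ IsMax j → W (F.map (homOfLE (Order.le_succ j)))) →
      PreservesColimit F (coyoneda.obj (Opposite.op A))

variable (C) in
/-- A model category is cofibrantly generated if there are sets `I` and `J` of morphisms, each
permitting the small object argument, such that the trivial fibrations are the morphisms with the
right lifting property with respect to `I` and the fibrations are the morphisms with the right
lifting property with respect to `J`. -/
def IsCofibrantlyGenerated [ModelCategory C] : Prop :=
  ∃ I J : MorphismProperty C, MorphismProperty.IsSmall.{v} I ∧ MorphismProperty.IsSmall.{v} J ∧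
    (∀ ⦃A B : C⦄ (i : A ⟶ B), I i → IsSmallRelativeTo (relativeCellComplexes I) A) ∧
    (∀ ⦃A B : C⦄ (j : A ⟶ B), J j → IsSmallRelativeTo (relativeCellComplexes J) A) ∧
    trivialFibrations C = I.rlp ∧ fibrations C = J.rlp

end

/-! The factorizations come from a small object argument enriched in `C(k)`. Given an arrow `x`, one
attaches for each generator `A_i ⟶ B_i` the map `A_i ⊙ H_i ⟶ B_i ⊙ H_i`, where `H_i` is the whole
complex of squares from the generator to `x` and not just the set of closed squares of degree zero.
The pushout (`CellAttachment`) has a universal property in all degrees and is therefore a dg functor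
of `x`. Iterating it transfinitely gives a dg functorial factorization. Two points need an argument.

Attaching such cells must stay inside `I.rlp.llp`. For `i : A ⟶ B` in this class and `p` in `I.rlp`,
consider the map from `M(B, X)` to the complex of squares from `i` to `p`. Stability under shifts
makes it surjective on cocycles, since cocycles of degree `n` become ordinary closed squares for a
shift of `i`. Stability under the identity cone makes it surjective in every degree, since closed
maps out of `iCone A` are arbitrary elements of degree `-1`. Over a field every complex is a sum of
spheres and disks, so every map of complexes lifts along such a surjection
(`exists_lift_of_surjective_on_cocycles`, `exists_enriched_lift`). Hence a lift can be chosen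
`k`-linearly and compatibly with differentials for all squares at once, which is what a map out of a
tensor requires (`CellAttachment.llp_inl`).

Smallness is assumed only relative to ordinary relative `I`-cell complexes, whereas the enriched
attachments are only known to lie in `I.rlp.llp`. So each middle object is carried along as a
retract of a second object, `big`, and the maps between these second objects are ordinary relative
cell complexes, provided by the ordinary small object argument (`exists_isCellular`). In the
colimit, a map from a small domain is pushed into `big`, factored through a stage there, and
retracted to the middle object of that stage. The second objects are chosen arrow by arrow and need
not be dg functorial.

Cotensors enter because they turn morphisms of degree `n` into closed ones
(`IsCotensored.exists_classifier`), so that ordinary colimits are dg colimits. -/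

/-! # Lifting maps of complexes over a field -/

section

variable {k : Type v} [Field k]

/-- Over a field, every map of complexes `K ⟶ Z` lifts along a map `W ⟶ Z` that is surjective in
each degree and on cocycles. -/
lemma exists_lift_of_surjective_on_cocycles {K W Z : CochainComplex (ModuleCat.{v} k) ℤ}
    (q : W ⟶ Z) (b : K ⟶ Z)
    (hq : ∀ (n : ℤ) (z : Z.X n), ∃ w : W.X n, (q.f n).hom w = z)
    (hq' : ∀ (n : ℤ) (z : Z.X n), (Z.d n (n + 1)).hom z = 0 →
      ∃ w : W.X n, (W.d n (n + 1)).hom w = 0 ∧ (q.f n).hom w = z) :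
    ∃ h : K ⟶ W, h ≫ q = b := by
  -- A partial inverse `γ` of the differential: a linear section of `d` over its image, extended to
  -- the whole space. It splits `K` into disks and spheres.
  have hγ : ∀ i j, ∃ γ : K.X j →ₗ[k] K.X i, ∀ x, (K.d i j).hom (γ ((K.d i j).hom x)) =
      (K.d i j).hom x := by
    intro i j
    obtain ⟨σ, hσ⟩ := (K.d i j).hom.rangeRestrict.exists_rightInverse_of_surjective
      (K.d i j).hom.range_rangeRestrict
    obtain ⟨γ, hγ⟩ := σ.exists_extend
    refine ⟨γ, fun x => ?_⟩
    have e := LinearMap.congr_fun hγ ((K.d i j).hom.rangeRestrict x)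
    have e' := congrArg Subtype.val (LinearMap.congr_fun hσ ((K.d i j).hom.rangeRestrict x))
    exact (congrArg (K.d i j).hom e).trans e'
  choose γ hγ using hγ
  have hθ : ∀ n, ∃ θ : K.X n →ₗ[k] W.X n, ∀ x, (q.f n).hom (θ x) = (b.f n).hom x := by
    intro n
    obtain ⟨σ, hσ⟩ := (q.f n).hom.exists_rightInverse_of_surjective
      (LinearMap.range_eq_top.2 (hq n))
    exact ⟨σ.comp (b.f n).hom, fun x => LinearMap.congr_fun hσ _⟩
  choose θ hθ using hθ
  have hζ : ∀ n, ∃ ζ : LinearMap.ker (Z.d n (n + 1)).hom →ₗ[k] W.X n,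
      ∀ x, (q.f n).hom (ζ x) = x.1 ∧ (W.d n (n + 1)).hom (ζ x) = 0 := by
    intro n
    let q' : LinearMap.ker (W.d n (n + 1)).hom →ₗ[k] LinearMap.ker (Z.d n (n + 1)).hom :=
      (q.f n).hom.restrict fun w hw => by
        have e := LinearMap.congr_fun (congrArg ModuleCat.Hom.hom (q.comm n (n + 1))) w
        change (Z.d n (n + 1)).hom ((q.f n).hom w) =
          (q.f (n + 1)).hom ((W.d n (n + 1)).hom w) at e
        rw [LinearMap.mem_ker] at hw ⊢
        rw [e, hw, map_zero]
    obtain ⟨σ, hσ⟩ := q'.exists_rightInverse_of_surjective (by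
      rw [LinearMap.range_eq_top]
      rintro ⟨z, hz⟩
      obtain ⟨w, hw, e⟩ := hq' n z hz
      exact ⟨⟨w, hw⟩, Subtype.ext e⟩)
    exact ⟨(Submodule.subtype _).comp σ, fun x =>
      ⟨congrArg Subtype.val (LinearMap.congr_fun hσ x), (σ x).2⟩⟩
  choose ζ hζ using hζ
  have dd : ∀ (L : CochainComplex (ModuleCat.{v} k) ℤ) (i j l : ℤ) (x : L.X i),
      (L.d j l).hom ((L.d i j).hom x) = 0 := fun L i j l x =>
    LinearMap.congr_fun (congrArg ModuleCat.Hom.hom (L.d_comp_d i j l)) x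
  have comm : ∀ {L L' : CochainComplex (ModuleCat.{v} k) ℤ} (φ : L ⟶ L') (i j : ℤ) (x : L.X i),
      (L'.d i j).hom ((φ.f i).hom x) = (φ.f j).hom ((L.d i j).hom x) := fun φ i j x =>
    LinearMap.congr_fun (congrArg ModuleCat.Hom.hom (φ.comm i j)) x
  -- The operator `1 - γ d - d γ` takes values in cocycles because `d γ d = d`.
  let ρ (n : ℤ) : K.X n →ₗ[k] LinearMap.ker (Z.d n (n + 1)).hom :=
    LinearMap.codRestrict _ ((b.f n).hom.comp (LinearMap.id -
      (γ n (n + 1)).comp (K.d n (n + 1)).hom - (K.d (n - 1) n).hom.comp (γ (n - 1) n)))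
      (fun x => by
        rw [LinearMap.mem_ker, LinearMap.comp_apply, comm]
        simp [hγ, dd])
  -- Written as `γ d + d γ + (1 - γ d - d γ)`, the identity of `K` is lifted term by term: the first
  -- by degreewise lifts `θ`, the second by differentials of such lifts, the third by cocycle lifts
  -- `ζ`.
  let h (n : ℤ) : K.X n →ₗ[k] W.X n :=
    (θ n).comp ((γ n (n + 1)).comp (K.d n (n + 1)).hom) +
      ((W.d (n - 1) n).hom.comp ((θ (n - 1)).comp (γ (n - 1) n))) + (ζ n).comp (ρ n)
  have h_apply : ∀ n x, h n x = θ n (γ n (n + 1) ((K.d n (n + 1)).hom x)) +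
      (W.d (n - 1) n).hom (θ (n - 1) (γ (n - 1) n x)) + ζ n (ρ n x) := fun _ _ => rfl
  -- On coboundaries only the middle term survives.
  have h_d : ∀ m n, m + 1 = n → ∀ x, h n ((K.d m n).hom x) =
      (W.d m n).hom (θ m (γ m n ((K.d m n).hom x))) := by
    intro m n hmn x
    obtain rfl : m = n - 1 := by omega
    have hρ : ρ n ((K.d (n - 1) n).hom x) = 0 := Subtype.ext (by simp [ρ, dd, hγ])
    rw [h_apply, hρ, dd]
    simp
  refine ⟨{ f := fun n => ModuleCat.ofHom (h n), comm' := ?_ }, ?_⟩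
  · intro i j hij
    obtain rfl : i + 1 = j := hij
    apply ModuleCat.hom_ext
    refine LinearMap.ext fun x => ?_
    change (W.d i (i + 1)).hom (h i x) = h (i + 1) ((K.d i (i + 1)).hom x)
    rw [h_d i _ rfl, h_apply, map_add, map_add, dd, (hζ i _).2, add_zero, add_zero]
  · ext n x
    change (q.f n).hom (h n x) = (b.f n).hom x
    rw [h_apply, map_add, map_add, hθ, (hζ n _).1, ← comm, hθ, comm]
    simp [ρ]

end

/-! ### Construction of dg functors, and composition with closed morphisms. -/

namespace DGCategory

variable {k : Type v} [CommRing k]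

/-- A relation between the morphisms of two dg categories which determines a dg functor with
given values on objects. -/
structure FunctorialRelation (k : Type v) [CommRing k] {M : Type u} [DGCategory k M] {N : Type u'}
    [DGCategory k N] (obj : M → N) where
  rel {X Y : M} (n : ℤ) : (hom k X Y).X n → (hom k (obj X) (obj Y)).X n → Prop
  ex {X Y : M} (n : ℤ) (x : (hom k X Y).X n) : ∃ y, rel n x y
  uniq {X Y : M} {n : ℤ} {x : (hom k X Y).X n} {y y'} : rel n x y → rel n x y' → y = y'
  add {X Y : M} {n : ℤ} {x x' : (hom k X Y).X n} {y y'} :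
    rel n x y → rel n x' y' → rel n (x + x') (y + y')
  smul {X Y : M} {n : ℤ} (c : k) {x : (hom k X Y).X n} {y} : rel n x y → rel n (c • x) (c • y)
  d {X Y : M} {n : ℤ} {x : (hom k X Y).X n} {y} : rel n x y →
    rel (n + 1) (((hom k X Y).d n (n + 1)).hom x) (((hom k (obj X) (obj Y)).d n (n + 1)).hom y)
  id (X : M) : rel 0 (DGCategory.id X) (DGCategory.id (obj X))
  comp {X Y Z : M} (p q n : ℤ) (h : p + q = n) {x : (hom k X Y).X p} {x' : (hom k Y Z).X q} {y y'} :
    rel p x y → rel q x' y' → rel n (DGCategory.comp p q n h x x') (DGCategory.comp p q n h y y')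

namespace FunctorialRelation

variable {M : Type u} [DGCategory k M] {N : Type u'} [DGCategory k N] {obj : M → N}
  (R : FunctorialRelation k obj)

/-- The dg functor determined by a functorial relation. -/
noncomputable def functor : DGFunctor k M N where
  obj := obj
  map X Y :=
    { f := fun n => ModuleCat.ofHom
        { toFun := fun x => (R.ex n x).choose
          map_add' := fun x x' => R.uniq (R.ex n _).choose_spec
            (R.add (R.ex n x).choose_spec (R.ex n x').choose_spec)
          map_smul' := fun c x => R.uniq (R.ex n _).choose_spec
            (R.smul c (R.ex n x).choose_spec) }
      comm' := fun i j hij => by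
        obtain rfl : i + 1 = j := hij
        apply ModuleCat.hom_ext
        exact LinearMap.ext fun x => R.uniq (R.d (R.ex i x).choose_spec)
          (R.ex (i + 1) _).choose_spec }
  map_id X := R.uniq (R.ex 0 _).choose_spec (R.id X)
  map_comp p q n h f g := R.uniq (R.ex n _).choose_spec
    (R.comp p q n h (R.ex p f).choose_spec (R.ex q g).choose_spec)

lemma rel_map {X Y : M} (n : ℤ) (x : (hom k X Y).X n) :
    R.rel n x (((R.functor.map X Y).f n).hom x) :=
  (R.ex n x).choose_spec

end FunctorialRelation

/-- The composition of dg functors. -/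
noncomputable def _root_.DGFunctor.comp {M : Type u} [DGCategory k M] {N : Type u'} [DGCategory k N]
    {P : Type*} [DGCategory k P] (F : DGFunctor k M N) (G : DGFunctor k N P) :
    DGFunctor k M P where
  obj X := G.obj (F.obj X)
  map X Y := F.map X Y ≫ G.map (F.obj X) (F.obj Y)
  map_id X := (congrArg ((G.map _ _).f 0).hom (F.map_id X)).trans (G.map_id _)
  map_comp p q n h f g := (congrArg ((G.map _ _).f n).hom (F.map_comp p q n h f g)).trans
    (G.map_comp p q n h _ _)

/-! # Composition with closed morphisms of degree zero -/

section

variable {M : Type u} [DGCategory k M]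

/-- Precomposition with a closed morphism of degree zero. -/
def pre {X Y : Underlying k M} (f : X ⟶ Y) {Z : M} {n : ℤ} :
    (hom k Y.as Z).X n →ₗ[k] (hom k X.as Z).X n :=
  comp 0 n n (zero_add n) (ClosedHom.val f)

/-- Postcomposition with a closed morphism of degree zero. -/
def post {Y Z : Underlying k M} (f : Y ⟶ Z) {X : M} {n : ℤ} :
    (hom k X Y.as).X n →ₗ[k] (hom k X Z.as).X n :=
  (comp n 0 n (add_zero n)).flip (ClosedHom.val f)

variable {W X Y Z : Underlying k M} {A B C : M} {n p q : ℤ}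

@[simp]
lemma pre_id (x : (hom k X.as A).X n) : pre (𝟙 X) x = x := DGCategory.id_comp n x

@[simp]
lemma post_id (x : (hom k A X.as).X n) : post (𝟙 X) x = x := DGCategory.comp_id n x

lemma pre_comp (f : X ⟶ Y) (g : Y ⟶ Z) (x : (hom k Z.as A).X n) :
    pre (f ≫ g) x = pre f (pre g x) :=
  DGCategory.assoc 0 0 n 0 n n _ _ _ _ _ _ _

lemma post_comp (f : X ⟶ Y) (g : Y ⟶ Z) (x : (hom k A X.as).X n) :
    post (f ≫ g) x = post g (post f x) :=
  (DGCategory.assoc n 0 0 n 0 n _ _ _ _ _ _ _).symm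

lemma post_pre (f : W ⟶ X) (x : (hom k X.as Y.as).X n) (g : Y ⟶ Z) :
    post g (pre f x) = pre f (post g x) :=
  DGCategory.assoc 0 n 0 n n n _ _ _ _ _ _ _

lemma comp_pre (h : p + q = n) (f : X ⟶ Y) (x : (hom k Y.as A).X p) (y : (hom k A B).X q) :
    comp p q n h (pre f x) y = pre f (comp p q n h x y) :=
  DGCategory.assoc 0 p q p n n _ _ _ _ _ _ _

lemma comp_post (h : p + q = n) (x : (hom k A B).X p) (f : X ⟶ Y) (y : (hom k B X.as).X q) :
    comp p q n h x (post f y) = post f (comp p q n h x y) :=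
  (DGCategory.assoc p q 0 n q n _ _ _ _ _ _ _).symm

lemma comp_pre_right (h : p + q = n) (x : (hom k A X.as).X p) (f : X ⟶ Y)
    (y : (hom k Y.as B).X q) : comp p q n h x (pre f y) = comp p q n h (post f x) y :=
  (DGCategory.assoc p 0 q p q n _ _ _ _ _ _ _).symm

lemma d_pre (f : X ⟶ Y) (i j : ℤ) (x : (hom k Y.as A).X i) :
    ((hom k X.as A).d i j).hom (pre f x) = pre f (((hom k Y.as A).d i j).hom x) := by
  by_cases hij : i + 1 = j
  · refine (d_comp' 0 i i 1 j j (zero_add i) (zero_add 1) hij hij _ _).trans ?_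
    rw [f.closed]
    simp [pre]
  · rw [(hom k X.as A).shape i j hij, (hom k Y.as A).shape i j hij]
    simp

lemma d_post (f : X ⟶ Y) (i j : ℤ) (x : (hom k A X.as).X i) :
    ((hom k A Y.as).d i j).hom (post f x) = post f (((hom k A X.as).d i j).hom x) := by
  by_cases hij : i + 1 = j
  · refine (d_comp' i 0 i j 1 j (add_zero i) hij (zero_add 1) hij _ _).trans ?_
    rw [f.closed]
    simp [post]
  · rw [(hom k A X.as).shape i j hij, (hom k A Y.as).shape i j hij]
    simp

lemma d_d (i j l : ℤ) (x : (hom k A B).X i) :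
    ((hom k A B).d j l).hom (((hom k A B).d i j).hom x) = 0 :=
  LinearMap.congr_fun (congrArg ModuleCat.Hom.hom ((hom k A B).d_comp_d i j l)) x

lemma pre_val (f : X ⟶ Y) (g : Y ⟶ Z) : pre f (ClosedHom.val g) = ClosedHom.val (f ≫ g) := rfl

lemma post_val (f : X ⟶ Y) (g : Y ⟶ Z) : post g (ClosedHom.val f) = ClosedHom.val (f ≫ g) := rfl

end

end DGCategory
-- Lifting properties in arbitrary degrees and the shift.
namespace DGCategory

section

variable {k : Type v} [CommRing k] {M : Type u} [DGCategory k M]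

/-- Transport of the identity of `A` to a degree which is equal to zero. -/
def idOfEq (k : Type v) [CommRing k] {M : Type u} [DGCategory k M] (A : M) {j : ℤ} (hj : 0 = j) :
    (hom k A A).X j :=
  hj ▸ DGCategory.id A

lemma d_idOfEq (A : M) {j : ℤ} (hj : 0 = j) (l : ℤ) :
    ((hom k A A).d j l).hom (idOfEq k A hj) = 0 := by
  subst hj
  by_cases hl : 0 + 1 = l
  · obtain rfl : 1 = l := by omega
    exact d_id A
  · rw [(hom k A A).shape 0 l hl]
    rfl

lemma pre_idOfEq {A B : Underlying k M} {j : ℤ} (hj : 0 = j) (f : A ⟶ B) :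
    pre f (idOfEq k B.as hj) = post f (idOfEq k A.as hj) := by
  subst hj
  exact (DGCategory.comp_id 0 (ClosedHom.val f)).trans (DGCategory.id_comp 0 _).symm

/-- The lifting property of `i` with respect to `p` for commutative squares of degree `n`. -/
def LiftsInDegree {A B X Y : Underlying k M} (i : A ⟶ B) (p : X ⟶ Y) (n : ℤ) : Prop :=
  ∀ (a : (hom k A.as X.as).X n) (b : (hom k B.as Y.as).X n), pre i b = post p a →
    ∃ x : (hom k B.as X.as).X n, pre i x = a ∧ post p x = b

/-- The lifting property of `i` with respect to `p` for closed commutative squares of degree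
`n`. -/
def LiftsCocycles {A B X Y : Underlying k M} (i : A ⟶ B) (p : X ⟶ Y) (n : ℤ) : Prop :=
  ∀ (a : (hom k A.as X.as).X n) (b : (hom k B.as Y.as).X n), pre i b = post p a →
    ((hom k A.as X.as).d n (n + 1)).hom a = 0 → ((hom k B.as Y.as).d n (n + 1)).hom b = 0 →
    ∃ x : (hom k B.as X.as).X n, pre i x = a ∧ post p x = b ∧
      ((hom k B.as X.as).d n (n + 1)).hom x = 0

lemma liftsCocycles_zero {A B X Y : Underlying k M} (i : A ⟶ B) (p : X ⟶ Y)
    [HasLiftingProperty i p] : LiftsCocycles i p 0 := by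
  intro a b h ha hb
  let a' : A ⟶ X := ⟨a, ha⟩
  let b' : B ⟶ Y := ⟨b, hb⟩
  have sq : CommSq a' i p b' := ⟨Underlying.hom_ext h.symm⟩
  exact ⟨ClosedHom.val sq.lift, congrArg ClosedHom.val sq.fac_left,
    congrArg ClosedHom.val sq.fac_right, sq.lift.closed⟩

namespace IsStronglyPretriangulated

variable (hM : IsStronglyPretriangulated k M)

/-- The defining isomorphism `Yo ([m] A) ≅ [m] Yo(A)`. -/
noncomputable def shiftIso (m : ℤ) :
    hM.shiftFunctor m ⋙ DGModule.yoneda k M ≅ DGModule.yoneda k M ⋙ DGModule.shift m :=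
  Functor.essImage.liftFunctorCompIso _ _ (hM.shift m)

/-- The defining isomorphism `Yo (Cone f) ≅ Cone (Yo f)`. -/
noncomputable def coneIso :
    hM.coneFunctor ⋙ DGModule.yoneda k M ≅ (DGModule.yoneda k M).mapArrow ⋙ DGModule.cone :=
  Functor.essImage.liftFunctorCompIso _ _ hM.cone

/-- The universal morphisms between an object and its shift. -/
lemma exists_shift_elements_aux (m m' n j : ℤ) (hm : 0 + m = m') (hj : n + m = j) (h : 0 = j) :
    ∃ (σ : ∀ A : Underlying k M, (hom k ((hM.shiftFunctor m).obj A).as A.as).X m')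
      (τ : ∀ A : Underlying k M, (hom k A.as ((hM.shiftFunctor m).obj A).as).X n),
      (∀ ⦃A B : Underlying k M⦄ (i : A ⟶ B),
        pre ((hM.shiftFunctor m).map i) (σ B) = post i (σ A)) ∧
      (∀ ⦃A B : Underlying k M⦄ (i : A ⟶ B),
        pre i (τ B) = post ((hM.shiftFunctor m).map i) (τ A)) ∧
      (∀ A, comp n m' j (by omega) (τ A) (σ A) = idOfEq k A.as h) ∧
      (∀ A l, ((hom k _ _).d m' l).hom (σ A) = 0) ∧
      (∀ A l, ((hom k _ _).d n l).hom (τ A) = 0) := by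
  subst hm hj
  let e := hM.shiftIso m
  have inv_hom : ∀ (A : Underlying k M) (Z : M) (q : ℤ) (x : (hom k Z A.as).X (q + m)),
      ((DGModule.Hom.app (e.hom.app A) Z).f q).hom
        (((DGModule.Hom.app (e.inv.app A) Z).f q).hom x) = x := by
    intro A Z q x
    exact LinearMap.congr_fun (congrArg ModuleCat.Hom.hom (congrArg
      (fun t => (DGModule.Hom.app t Z).f q) (e.inv_hom_id_app A))) x
  have nat_hom : ∀ {A B : Underlying k M} (i : A ⟶ B) (Z : M) (q : ℤ)
      (x : (hom k Z ((hM.shiftFunctor m).obj A).as).X q),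
      (((DGModule.Hom.app (e.hom.app B) Z).f q).hom (post ((hM.shiftFunctor m).map i) x) :
        (hom k Z B.as).X (q + m)) =
        post i (((DGModule.Hom.app (e.hom.app A) Z).f q).hom x : (hom k Z A.as).X (q + m)) := by
    intro A B i Z q x
    exact LinearMap.congr_fun (congrArg ModuleCat.Hom.hom (congrArg
      (fun t => (DGModule.Hom.app t Z).f q) (e.hom.naturality i))) x
  have nat_inv : ∀ {A B : Underlying k M} (i : A ⟶ B) (Z : M) (q : ℤ)
      (x : (hom k Z A.as).X (q + m)),
      ((DGModule.Hom.app (e.inv.app B) Z).f q).hom (post i x) =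
        post ((hM.shiftFunctor m).map i) (((DGModule.Hom.app (e.inv.app A) Z).f q).hom x) := by
    intro A B i Z q x
    exact LinearMap.congr_fun (congrArg ModuleCat.Hom.hom (congrArg
      (fun t => (DGModule.Hom.app t Z).f q) (e.inv.naturality i))) x
  -- By Yoneda, `σ` is the image of the identity of `[m] A` and `τ` the preimage of the identity of
  -- `A`. The component of degree `q` of a shifted complex is indexed by `q + m`, which forces the
  -- spare indices `m'` and `j`.
  refine ⟨fun A => ((DGModule.Hom.app (e.hom.app A) _).f 0).hom (DGCategory.id _),
    fun A => ((DGModule.Hom.app (e.inv.app A) _).f n).hom (idOfEq k A.as h), ?_, ?_, ?_, ?_, ?_⟩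
  · intro A B i
    refine ((DGModule.Hom.app_act (e.hom.app B) 0 0 0 (zero_add 0)
      (ClosedHom.val ((hM.shiftFunctor m).map i)) (DGCategory.id _)).symm.trans ?_).trans
      (nat_hom i _ 0 (DGCategory.id _))
    exact congrArg ((DGModule.Hom.app (e.hom.app B) _).f 0).hom
      ((DGCategory.comp_id 0 _).trans (DGCategory.id_comp 0 _).symm)
  · intro A B i
    refine ((DGModule.Hom.app_act (e.inv.app B) 0 n n (zero_add n)
      (ClosedHom.val i) (idOfEq k B.as h)).symm.trans ?_).trans
      (nat_inv i _ n (idOfEq k A.as h))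
    exact congrArg ((DGModule.Hom.app (e.inv.app B) _).f n).hom (pre_idOfEq h i)
  · intro A
    refine Eq.trans ?_ (inv_hom A _ n (idOfEq k A.as h))
    refine (DGModule.Hom.app_act (e.hom.app A) n 0 n (add_zero n) _ (DGCategory.id _)).symm.trans ?_
    exact congrArg ((DGModule.Hom.app (e.hom.app A) _).f n).hom (DGCategory.comp_id n _)
  · intro A l
    by_cases hl : 0 + m + 1 = l
    · obtain rfl : 0 + 1 + m = l := by omega
      have e₁ := LinearMap.congr_fun (congrArg ModuleCat.Hom.hom
        ((DGModule.Hom.app (e.hom.app A) _).comm 0 (0 + 1))) (DGCategory.id _)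
      -- The differential of the shifted module carries the sign `(-1)^m`, which is invertible.
      have e₂ : m.negOnePow • ((hom k ((hM.shiftFunctor m).obj A).as A.as).d (0 + m) (0 + 1 + m)).hom
        (((DGModule.Hom.app (e.hom.app A) _).f 0).hom (DGCategory.id _)) = 0 := by
        refine e₁.trans ?_
        refine Eq.trans (congrArg ((DGModule.Hom.app (e.hom.app A) _).f 1).hom (DGCategory.d_id _)) ?_
        exact map_zero ((DGModule.Hom.app (e.hom.app A) _).f 1).hom
      rwa [smul_eq_zero_iff_eq] at e₂
    · rw [(hom k _ _).shape _ _ hl]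
      rfl
  · intro A l
    by_cases hl : n + 1 = l
    · obtain rfl := hl
      have e₁ := LinearMap.congr_fun (congrArg ModuleCat.Hom.hom
        ((DGModule.Hom.app (e.inv.app A) A.as).comm n (n + 1))) (idOfEq k A.as h)
      refine e₁.trans ?_
      refine Eq.trans (congrArg ((DGModule.Hom.app (e.inv.app A) _).f (n + 1)).hom
        (?_ : m.negOnePow • ((hom k A.as A.as).d (n + m) (n + 1 + m)).hom (idOfEq k A.as h) = 0)) ?_
      · rw [d_idOfEq, smul_zero]
      · exact map_zero ((DGModule.Hom.app (e.inv.app A) _).f (n + 1)).hom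
    · rw [(hom k _ _).shape _ _ hl]
      rfl

/-- Composing with the closed natural elements `σ` and `τ` trades squares of degree `n` on `i` for
squares of degree `m + n` on `[m] i`, and back. -/
lemma exists_shift_elements (m n : ℤ) (h : n + m = 0) :
    ∃ (σ : ∀ A : Underlying k M, (hom k ((hM.shiftFunctor m).obj A).as A.as).X m)
      (τ : ∀ A : Underlying k M, (hom k A.as ((hM.shiftFunctor m).obj A).as).X n),
      (∀ ⦃A B : Underlying k M⦄ (i : A ⟶ B),
        pre ((hM.shiftFunctor m).map i) (σ B) = post i (σ A)) ∧
      (∀ ⦃A B : Underlying k M⦄ (i : A ⟶ B),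
        pre i (τ B) = post ((hM.shiftFunctor m).map i) (τ A)) ∧
      (∀ A, comp n m 0 h (τ A) (σ A) = DGCategory.id A.as) ∧
      (∀ A l, ((hom k _ _).d m l).hom (σ A) = 0) ∧
      (∀ A l, ((hom k _ _).d n l).hom (τ A) = 0) :=
  hM.exists_shift_elements_aux m m n 0 (zero_add m) h rfl

end IsStronglyPretriangulated

end

end DGCategory
-- The identity cone and lifts with complexes of parameters.
namespace DGCategory

section

variable {k : Type v} [CommRing k] {M : Type u} [DGCategory k M]

namespace IsStronglyPretriangulated

variable (hM : IsStronglyPretriangulated k M)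

/-- The universal morphisms between an object and its identity cone. -/
lemma exists_iCone_elements :
    ∃ (π₀ : ∀ A : Underlying k M, (hom k (hM.iCone.obj A).as A.as).X 0)
      (π₁ : ∀ A : Underlying k M, (hom k (hM.iCone.obj A).as A.as).X 1)
      (τ : ∀ A : Underlying k M, (hom k A.as (hM.iCone.obj A).as).X (-1)),
      (∀ ⦃A B : Underlying k M⦄ (i : A ⟶ B), pre (hM.iCone.map i) (π₀ B) = post i (π₀ A)) ∧
      (∀ ⦃A B : Underlying k M⦄ (i : A ⟶ B), pre (hM.iCone.map i) (π₁ B) = post i (π₁ A)) ∧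
      (∀ ⦃A B : Underlying k M⦄ (i : A ⟶ B), pre i (τ B) = post (hM.iCone.map i) (τ A)) ∧
      (∀ A, comp (-1) 0 (-1) (by omega) (τ A) (π₀ A) = 0) ∧
      (∀ A, comp (-1) 1 0 (by omega) (τ A) (π₁ A) = DGCategory.id A.as) ∧
      (∀ A, ((hom k _ _).d 0 1).hom (π₀ A) = - π₁ A) ∧
      (∀ A, ((hom k _ _).d 1 2).hom (π₁ A) = 0) := by
  let F : Underlying k M ⥤ Arrow (Underlying k M) :=
    { obj := fun X => Arrow.mk (𝟙 X)
      map := fun f => Arrow.homMk f f }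
  let e : hM.iCone ⋙ DGModule.yoneda k M ≅
      F ⋙ (DGModule.yoneda k M).mapArrow ⋙ DGModule.cone := Functor.isoWhiskerLeft F hM.coneIso
  have inv_hom : ∀ (A : Underlying k M) (Z : M) (q : ℤ)
      (x : (hom k Z A.as).X q × (hom k Z A.as).X (q + 1)),
      ((DGModule.Hom.app (e.hom.app A) Z).f q).hom
        (((DGModule.Hom.app (e.inv.app A) Z).f q).hom x) = x := by
    intro A Z q x
    exact LinearMap.congr_fun (congrArg ModuleCat.Hom.hom (congrArg
      (fun t => (DGModule.Hom.app t Z).f q) (e.inv_hom_id_app A))) x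
  have nat_hom : ∀ {A B : Underlying k M} (i : A ⟶ B) (Z : M) (q : ℤ)
      (x : (hom k Z (hM.iCone.obj A).as).X q),
      (((DGModule.Hom.app (e.hom.app B) Z).f q).hom (post (hM.iCone.map i) x) :
        (hom k Z B.as).X q × (hom k Z B.as).X (q + 1)) =
        Prod.map (post i) (post i) (((DGModule.Hom.app (e.hom.app A) Z).f q).hom x :
          (hom k Z A.as).X q × (hom k Z A.as).X (q + 1)) := by
    intro A B i Z q x
    exact LinearMap.congr_fun (congrArg ModuleCat.Hom.hom (congrArg
      (fun t => (DGModule.Hom.app t Z).f q) (e.hom.naturality i))) x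
  have nat_inv : ∀ {A B : Underlying k M} (i : A ⟶ B) (Z : M) (q : ℤ)
      (x : (hom k Z A.as).X q × (hom k Z A.as).X (q + 1)),
      ((DGModule.Hom.app (e.inv.app B) Z).f q).hom (Prod.map (post i) (post i) x :
          (hom k Z B.as).X q × (hom k Z B.as).X (q + 1)) =
        post (hM.iCone.map i) (((DGModule.Hom.app (e.inv.app A) Z).f q).hom x) := by
    intro A B i Z q x
    exact LinearMap.congr_fun (congrArg ModuleCat.Hom.hom (congrArg
      (fun t => (DGModule.Hom.app t Z).f q) (e.inv.naturality i))) x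
  -- The universal element: the image of the identity of `iCone A`. Its two coordinates live in
  -- degrees `0` and `1` because `Cone (𝟙 A)` is `A ⊕ A[1]`.
  let π (A : Underlying k M) : (hom k (hM.iCone.obj A).as A.as).X 0 ×
      (hom k (hM.iCone.obj A).as A.as).X 1 :=
    ((DGModule.Hom.app (e.hom.app A) _).f 0).hom (DGCategory.id _)
  let τ (A : Underlying k M) : (hom k A.as (hM.iCone.obj A).as).X (-1) :=
    ((DGModule.Hom.app (e.inv.app A) A.as).f (-1)).hom
      ((0, DGCategory.id A.as) : (hom k A.as A.as).X (-1) × (hom k A.as A.as).X 0)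
  have hπ : ∀ ⦃A B : Underlying k M⦄ (i : A ⟶ B),
      Prod.map (pre (hM.iCone.map i)) (pre (hM.iCone.map i)) (π B) =
        Prod.map (post i) (post i) (π A) := by
    intro A B i
    refine ((DGModule.Hom.app_act (e.hom.app B) 0 0 0 (zero_add 0)
      (ClosedHom.val (hM.iCone.map i)) (DGCategory.id _)).symm.trans ?_).trans
      (nat_hom i _ 0 (DGCategory.id _))
    exact congrArg ((DGModule.Hom.app (e.hom.app B) _).f 0).hom
      ((DGCategory.comp_id 0 _).trans (DGCategory.id_comp 0 _).symm)
  have hτπ : ∀ A, ((comp (-1) 0 (-1) (by omega) (τ A) (π A).1,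
      comp (-1) 1 0 (by omega) (τ A) (π A).2) :
        (hom k A.as A.as).X (-1) × (hom k A.as A.as).X 0) = (0, DGCategory.id A.as) := by
    intro A
    refine Eq.trans ?_ (inv_hom A _ (-1) _)
    refine (DGModule.Hom.app_act (e.hom.app A) (-1) 0 (-1) (by omega) _
      (DGCategory.id _)).symm.trans ?_
    exact congrArg ((DGModule.Hom.app (e.hom.app A) _).f (-1)).hom (DGCategory.comp_id (-1) _)
  -- The identity is closed, so the cone differential kills its image `(π₀, π₁)`.
  have hd : ∀ A, ((((hom k _ _).d 0 1).hom (π A).1 + (π A).2, -((hom k _ _).d 1 2).hom (π A).2) :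
      (hom k (hM.iCone.obj A).as A.as).X 1 × (hom k (hM.iCone.obj A).as A.as).X 2) = (0, 0) := by
    intro A
    have e₁ := LinearMap.congr_fun (congrArg ModuleCat.Hom.hom
      ((DGModule.Hom.app (e.hom.app A) _).comm 0 (0 + 1))) (DGCategory.id _)
    have e₂ := (DGModule.coneComplex_d_apply _ 0 (π A)).symm.trans e₁
    have e₃ : ((((hom k _ _).d 0 1).hom (π A).1 + post (𝟙 A) (π A).2,
        -((hom k _ _).d 1 2).hom (π A).2) : (hom k (hM.iCone.obj A).as A.as).X 1 ×
          (hom k (hM.iCone.obj A).as A.as).X 2) = (0, 0) := by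
      refine e₂.trans (Eq.trans (congrArg ((DGModule.Hom.app (e.hom.app A) _).f 1).hom
        (DGCategory.d_id _)) ?_)
      exact map_zero ((DGModule.Hom.app (e.hom.app A) _).f 1).hom
    rwa [post_id] at e₃
  refine ⟨fun A => (π A).1, fun A => (π A).2, τ, fun A B i => congrArg Prod.fst (hπ i),
    fun A B i => congrArg Prod.snd (hπ i), ?_, fun A => congrArg Prod.fst (hτπ A),
    fun A => congrArg Prod.snd (hτπ A), fun A => eq_neg_of_add_eq_zero_left
      (congrArg Prod.fst (hd A)), fun A => neg_eq_zero.1 (congrArg Prod.snd (hd A))⟩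
  intro A B i
  refine ((DGModule.Hom.app_act (e.inv.app B) 0 (-1) (-1) (by omega)
    (ClosedHom.val i) _).symm.trans ?_).trans (nat_inv i _ (-1) _)
  refine congrArg ((DGModule.Hom.app (e.inv.app B) _).f (-1)).hom (Prod.ext ?_ ?_)
  · exact (map_zero (pre i)).trans (map_zero (post i)).symm
  · exact (DGCategory.comp_id 0 _).trans (DGCategory.id_comp 0 _).symm

variable {A B X Y : Underlying k M} (i : A ⟶ B) (p : X ⟶ Y)

/-- Closed maps `iCone C ⟶ Z` are the same as arbitrary elements of degree `-1` of `M(C, Z)`,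
naturally in `C` and `Z`, so an ordinary lift for `iCone i` is a lift of degree `-1` for `i`. -/
lemma liftsInDegree_neg_one [HasLiftingProperty (hM.iCone.map i) p] : LiftsInDegree i p (-1) := by
  obtain ⟨π₀, π₁, τ, hπ₀, hπ₁, hτ, h₀, h₁, hd₀, hd₁⟩ := hM.exists_iCone_elements
  -- In the differential, the two copies of `π₁` followed by `d a` cancel because `d π₀ = - π₁`.
  -- Precomposing with `τ` recovers `a`, as `τ` followed by `π₁` is the identity and `τ` followed by
  -- `π₀` vanishes.
  let ψ (C Z : Underlying k M) (a : (hom k C.as Z.as).X (-1)) : hM.iCone.obj C ⟶ Z :=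
    { val := comp 1 (-1) 0 (by omega) (π₁ C) a +
        comp 0 0 0 (by omega) (π₀ C) (((hom k C.as Z.as).d (-1) 0).hom a)
      closed := by
        rw [map_add, d_comp' 1 (-1) 0 2 0 1 _ (by omega) (by omega) (by omega), hd₁,
          d_comp' 0 0 0 1 1 1 _ (by omega) (by omega) (by omega), d_d, hd₀]
        simp }
  intro a b h
  have sq : CommSq (ψ A X a) (hM.iCone.map i) p (ψ B Y b) := by
    refine ⟨Underlying.hom_ext ?_⟩
    rw [← post_val, ← pre_val]
    dsimp only [ψ]
    rw [map_add, map_add, ← comp_post, ← comp_post, ← comp_pre, ← comp_pre, hπ₁, hπ₀,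
      ← comp_pre_right, ← comp_pre_right, ← d_pre, h, d_post]
  have key : ∀ (C : Underlying k M) (Z : Underlying k M) (a : (hom k C.as Z.as).X (-1)),
      post (ψ C Z a) (τ C) = a := by
    intro C Z a
    change comp (-1) 0 (-1) _ (τ C) (comp 1 (-1) 0 _ (π₁ C) a + comp 0 0 0 _ (π₀ C) _) = a
    rw [map_add, ← DGCategory.assoc (-1) 1 (-1) 0 0 (-1) (by omega) (by omega) (by omega)
      (by omega), h₁, DGCategory.id_comp,
      ← DGCategory.assoc (-1) 0 0 (-1) 0 (-1) (by omega) (by omega) (by omega) (by omega), h₀]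
    simp
  refine ⟨post sq.lift (τ B), ?_, ?_⟩
  · rw [← post_pre, hτ, ← post_comp, sq.fac_left, key]
  · rw [← post_comp, sq.fac_right, key]

variable {m n n' : ℤ} (h : m + n = n')

include h in
lemma liftsInDegree_of_shift (hi : LiftsInDegree ((hM.shiftFunctor m).map i) p n') :
    LiftsInDegree i p n := by
  obtain ⟨σ, τ, hσ, hτ, hτσ, dσ, dτ⟩ := hM.exists_shift_elements m (-m) (by omega)
  intro a b e
  obtain ⟨x, hx, hx'⟩ := hi (comp m n n' h (σ A) a) (comp m n n' h (σ B) b) (by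
    rw [← comp_pre, hσ, ← comp_pre_right, e, comp_post])
  refine ⟨comp (-m) n' n (by omega) (τ B) x, ?_, ?_⟩
  · rw [← comp_pre, hτ, ← comp_pre_right, hx, ← DGCategory.assoc (-m) m n 0 n' n (by omega)
      (by omega) (by omega), hτσ, DGCategory.id_comp]
  · rw [← comp_post, hx', ← DGCategory.assoc (-m) m n 0 n' n (by omega)
      (by omega) (by omega), hτσ, DGCategory.id_comp]

include h in
-- As for squares of arbitrary elements; cocycles are preserved in both directions because `σ` and
-- `τ` are closed.
lemma liftsCocycles_of_shift (hi : LiftsCocycles ((hM.shiftFunctor m).map i) p n') :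
    LiftsCocycles i p n := by
  obtain ⟨σ, τ, hσ, hτ, hτσ, dσ, dτ⟩ := hM.exists_shift_elements m (-m) (by omega)
  intro a b e ha hb
  obtain ⟨x, hx, hx', dx⟩ := hi (comp m n n' h (σ A) a) (comp m n n' h (σ B) b) (by
      rw [← comp_pre, hσ, ← comp_pre_right, e, comp_post])
    (by rw [d_comp' m n n' _ _ _ h rfl rfl rfl, ha, dσ]; simp)
    (by rw [d_comp' m n n' _ _ _ h rfl rfl rfl, hb, dσ]; simp)
  refine ⟨comp (-m) n' n (by omega) (τ B) x, ?_, ?_, ?_⟩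
  · rw [← comp_pre, hτ, ← comp_pre_right, hx, ← DGCategory.assoc (-m) m n 0 n' n (by omega)
      (by omega) (by omega), hτσ, DGCategory.id_comp]
  · rw [← comp_post, hx', ← DGCategory.assoc (-m) m n 0 n' n (by omega)
      (by omega) (by omega), hτσ, DGCategory.id_comp]
  · rw [d_comp' (-m) n' n _ _ _ (by omega) rfl rfl rfl, dx, dτ]; simp

end IsStronglyPretriangulated

end

/-- A class of morphisms is stable under shifts and identity cones. -/
structure IsStronglyPretriangulated.Stable {k : Type v} [CommRing k] {M : Type u} [DGCategory k M]
    (hM : IsStronglyPretriangulated k M) (W : MorphismProperty (Underlying k M)) : Prop where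
  shift (n : ℤ) ⦃E F : Underlying k M⦄ (i : E ⟶ F) : W i → W ((hM.shiftFunctor n).map i)
  iCone ⦃E F : Underlying k M⦄ (i : E ⟶ F) : W i → W (hM.iCone.map i)

/-- Over a field, a morphism in a class stable under shifts and identity cones has the left
lifting property, with complexes of parameters, with respect to morphisms with the right lifting
property with respect to this class. -/
lemma exists_enriched_lift {k : Type v} [Field k] {M : Type u} [DGCategory k M]
    (hM : IsStronglyPretriangulated k M) {W : MorphismProperty (Underlying k M)}
    (hW : hM.Stable W) {A B X Y : Underlying k M} (i : A ⟶ B) (hi : W i) (p : X ⟶ Y) (hp : W.rlp p)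
    {K : CochainComplex (ModuleCat.{v} k) ℤ} (b : K ⟶ arrowHomComplex (Arrow.mk i) (Arrow.mk p)) :
    ∃ l : K ⟶ hom k B.as X.as, ∀ (n : ℤ) (x : K.X n),
      pre i ((l.f n).hom x) = ((b.f n).hom x : arrowHom (Arrow.mk i) (Arrow.mk p) n).1.1 ∧
      post p ((l.f n).hom x) = ((b.f n).hom x : arrowHom (Arrow.mk i) (Arrow.mk p) n).1.2 := by
  -- The shift by `-n` brings cocycles of degree `n` to degree `0`, where the ordinary lifting
  -- property applies.
  have h₁ : ∀ n, LiftsCocycles i p n := fun n => by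
    have := hp _ (hW.shift (-n) i hi)
    exact hM.liftsCocycles_of_shift i p (m := -n) (n' := 0) (by omega) (liftsCocycles_zero _ _)
  -- The shift by `-1 - n` brings degree `n` to degree `-1`, where the identity cone applies.
  have h₂ : ∀ n, LiftsInDegree i p n := fun n => by
    have := hp _ (hW.iCone _ (hW.shift (-1 - n) i hi))
    exact hM.liftsInDegree_of_shift i p (m := -1 - n) (n' := -1) (by omega)
      (hM.liftsInDegree_neg_one _ _)
  let q : hom k B.as X.as ⟶ arrowHomComplex (Arrow.mk i) (Arrow.mk p) :=
    { f := fun n => ModuleCat.ofHom (LinearMap.codRestrict (arrowHom (Arrow.mk i) (Arrow.mk p) n)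
        ((pre i).prod (post p)) (fun x => (post_pre i x p).symm))
      comm' := fun j l _ => by
        apply ModuleCat.hom_ext
        refine LinearMap.ext fun x => Subtype.ext (Prod.ext ?_ ?_)
        · exact d_pre i j l x
        · exact d_post p j l x }
  -- `h₂` is surjectivity of `q` in each degree and `h₁` is surjectivity on cocycles.
  obtain ⟨l, hl⟩ := exists_lift_of_surjective_on_cocycles q b
    (fun n ⟨⟨x, y⟩, hz⟩ => by
      obtain ⟨w, hw, hw'⟩ := h₂ n x y hz
      exact ⟨w, Subtype.ext (Prod.ext hw hw')⟩)
    (fun n ⟨⟨x, y⟩, hz⟩ dz => by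
      obtain ⟨w, hw, hw', dw⟩ := h₁ n x y hz (congrArg (fun t => t.1.1) dz)
        (congrArg (fun t => t.1.2) dz)
      exact ⟨w, dw, Subtype.ext (Prod.ext hw hw')⟩)
  refine ⟨l, fun n x => ?_⟩
  have e : (arrowHom (Arrow.mk i) (Arrow.mk p) n).subtype
      ((q.f n).hom ((l.f n).hom x)) = (arrowHom (Arrow.mk i) (Arrow.mk p) n).subtype
      ((b.f n).hom x) := by
    rw [← hl]; rfl
  exact ⟨congrArg Prod.fst e, congrArg Prod.snd e⟩

end DGCategory
-- Universal properties of tensors, cotensors and colimits in all degrees.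
namespace DGCategory

section

variable {k : Type v} [CommRing k]

/-- `D` is the complex freely generated by one element `e` of degree `n`; it corepresents the degree
`n` component, whose elements are the maps out of `k`. -/
lemma exists_corepresents_degree (n : ℤ) : ∃ (D : CochainComplex (ModuleCat.{v} k) ℤ) (e : D.X n),
    ∀ (L : CochainComplex (ModuleCat.{v} k) ℤ) (y : L.X n), ∃! φ : D ⟶ L, (φ.f n).hom e = y := by
  let r := HomologicalComplex.evalCompCoyonedaCorepresentable (ComplexShape.up ℤ)
    (ModuleCat.of k k) n
  refine ⟨_, (r.homEquiv (𝟙 _) : ModuleCat.of k k ⟶ _).hom 1, fun L y => ?_⟩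
  have hr : ∀ φ, (r.homEquiv φ : ModuleCat.of k k ⟶ L.X n).hom 1 =
      (φ.f n).hom ((r.homEquiv (𝟙 _) : ModuleCat.of k k ⟶ _).hom 1) := by
    intro φ
    have e := r.homEquiv_comp φ (𝟙 _)
    rw [Category.id_comp] at e
    rw [e]
    rfl
  obtain ⟨ψ, hψ⟩ := r.homEquiv.surjective
    (show ModuleCat.of k k ⟶ L.X n from ModuleCat.ofHom (LinearMap.toSpanSingleton k _ y))
  refine ⟨ψ, ?_, ?_⟩
  · dsimp only
    rw [← hr, hψ]
    exact one_smul k y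
  · intro φ hφ
    apply r.homEquiv.injective
    rw [hψ]
    apply ModuleCat.hom_ext
    apply LinearMap.ext_ring
    rw [hr, hφ]
    exact (one_smul k y).symm

variable {M : Type u} [DGCategory k M]

/-- Postcomposition with a closed morphism, as a map of complexes. -/
noncomputable def postMap (A : M) {X Y : Underlying k M} (f : X ⟶ Y) :
    hom k A X.as ⟶ hom k A Y.as where
  f _ := ModuleCat.ofHom (post f)
  comm' i j _ := ModuleCat.hom_ext (LinearMap.ext fun x => d_post f i j x)

/-- Precomposition with a closed morphism, as a map of complexes. -/
noncomputable def preMap {X Y : Underlying k M} (f : X ⟶ Y) (A : M) :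
    hom k Y.as A ⟶ hom k X.as A where
  f _ := ModuleCat.ofHom (pre f)
  comm' i j _ := ModuleCat.hom_ext (LinearMap.ext fun x => d_pre f i j x)

lemma comm_apply {K L : CochainComplex (ModuleCat.{v} k) ℤ} (φ : K ⟶ L) (i j : ℤ) (x : K.X i) :
    (L.d i j).hom ((φ.f i).hom x) = (φ.f j).hom ((K.d i j).hom x) :=
  LinearMap.congr_fun (congrArg ModuleCat.Hom.hom (φ.comm i j)) x

variable (k) in
/-- The cast of a morphism along an equality of degrees, as a linear map. -/
def degreeCast (A B : M) {p q : ℤ} (h : p + 0 = q) : (hom k A B).X p →ₗ[k] (hom k A B).X q :=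
  (comp p 0 q h).flip (DGCategory.id B)

@[simp]
lemma degreeCast_self (A B : M) {p : ℤ} (x : (hom k A B).X p) :
    degreeCast k A B (add_zero p) x = x := DGCategory.comp_id p x

section

variable {K : CochainComplex (ModuleCat.{v} k) ℤ} {X P : M} (η : K ⟶ hom k X P)

/-- A map `η : K ⟶ M(X, P)` exhibits `P` as the tensor of `X` by `K`. -/
structure ExhibitsTensor : Prop where
  desc {N : M} {n : ℤ} (b : ∀ p q (_ : p + n = q), K.X p →ₗ[k] (hom k X N).X q) :
    ∃ g : (hom k P N).X n, ∀ p q (h : p + n = q) x, comp p n q h ((η.f p).hom x) g = b p q h x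
  ext {N : M} {n : ℤ} {g g' : (hom k P N).X n} (h : ∀ p q (h : p + n = q) x,
    comp p n q h ((η.f p).hom x) g = comp p n q h ((η.f p).hom x) g') : g = g'

variable {η}

/-- A map of complexes is in particular a graded family of degree zero. The resulting `g` is closed
by uniqueness in degree `1`: by the Leibniz rule `d g` vanishes after composition with every `η x`.
-/
lemma ExhibitsTensor.descClosed (hη : ExhibitsTensor η) {N : M} (a : K ⟶ hom k X N) :
    ∃ g : Underlying.of (k := k) P ⟶ Underlying.of N,
      ∀ p x, post g ((η.f p).hom x) = (a.f p).hom x := by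
  obtain ⟨g, hg⟩ := hη.desc (fun p q h => (degreeCast k X N h).comp (a.f p).hom)
  refine ⟨⟨g, hη.ext fun p q h x => ?_⟩, fun p x => (hg p p (add_zero p) x).trans
    (degreeCast_self _ _ _)⟩
  have e := d_comp' p 0 p q 1 q (add_zero p) h (zero_add 1) h ((η.f p).hom x) g
  rw [hg, comm_apply, hg] at e
  dsimp only [LinearMap.comp_apply] at e
  rw [degreeCast_self, degreeCast_self, comm_apply, Int.negOnePow_zero, one_smul] at e
  rw [map_zero]
  exact right_eq_add.1 e

end

lemma IsTensored.exists_tensor (h : IsTensored k M) (K : CochainComplex (ModuleCat.{v} k) ℤ)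
    (X : M) : ∃ (P : Underlying k M) (η : K ⟶ hom k X P.as), ExhibitsTensor η := by
  obtain ⟨P, η, hη⟩ := h K X
  refine ⟨.of P, η, ⟨fun {N n} b => ?_, fun {N n g g'} e => ?_⟩⟩
  · obtain ⟨g, hg⟩ := (hη N n).2
      (CochainComplex.HomComplex.Cochain.mk fun p q hpq => ModuleCat.ofHom (b p q hpq))
    refine ⟨g, fun p q h x => ?_⟩
    exact LinearMap.congr_fun (congrArg ModuleCat.Hom.hom
      (CochainComplex.HomComplex.Cochain.congr_v hg p q h)) x
  · apply (hη N n).1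
    ext p q hpq : 1
    exact ModuleCat.hom_ext (LinearMap.ext (e p q hpq))

/-- In a cotensored dg category, morphisms of degree `n` to `N` are corepresented by closed
morphisms of degree zero to an object `Q`. -/
lemma IsCotensored.exists_classifier (h : IsCotensored k M) (N : M) (n : ℤ) :
    ∃ (Q : Underlying k M) (ε : (hom k Q.as N).X n),
      (∀ {X : Underlying k M} (y : (hom k X.as N).X n), ∃ f : X ⟶ Q, pre f ε = y) ∧
      ∀ {X : Underlying k M} {f g : X ⟶ Q}, pre f ε = pre g ε → f = g := by
  obtain ⟨D, e, hD⟩ := exists_corepresents_degree (k := k) n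
  -- `Q` is the cotensor `Ψ(D, N)`: closed maps `X ⟶ Q` are maps of complexes `D ⟶ M(X, N)`, hence
  -- elements of degree `n`.
  obtain ⟨Q, ε, hε⟩ := h D N
  have key : ∀ (X : M) (m p q : ℤ) (h : p + m = q) (f : (hom k X Q).X m) (x : D.X p),
      ((cotensorComparison ε X m f).v p q h).hom x =
        (m * p).negOnePow • comp m p q (by omega) f ((ε.f p).hom x) := fun _ _ _ _ _ _ _ => rfl
  refine ⟨.of Q, (ε.f n).hom e, fun {X} y => ?_, fun {X f g} hfg => ?_⟩
  · obtain ⟨φ, hφ, -⟩ := hD _ y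
    obtain ⟨f, hf⟩ := (hε X.as 0).2 (CochainComplex.HomComplex.Cochain.ofHom φ)
    have hf' : ∀ p x, comp 0 p p (zero_add p) f ((ε.f p).hom x) = (φ.f p).hom x := by
      intro p x
      have := LinearMap.congr_fun (congrArg ModuleCat.Hom.hom
        (CochainComplex.HomComplex.Cochain.congr_v hf p p (add_zero p))) x
      rw [key, CochainComplex.HomComplex.Cochain.ofHom_v] at this
      simpa using this
    -- Closedness of `f` is tested by the injectivity of the comparison in degree `1`, where the
    -- Leibniz rule and the compatibility of `φ` with `d` give zero.
    refine ⟨⟨f, (hε X.as 1).1 ?_⟩, (hf' n e).trans hφ⟩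
    refine CochainComplex.HomComplex.Cochain.ext _ _ fun p q hpq => ?_
    refine ModuleCat.hom_ext (LinearMap.ext fun x => ?_)
    rw [key, key]
    have e := d_comp' 0 p p 1 q q (zero_add p) (zero_add 1) hpq hpq f ((ε.f p).hom x)
    rw [hf', comm_apply, comm_apply, hf'] at e
    rw [one_mul, left_eq_add.1 e]
    simp
  · let φ (f : X ⟶ .of Q) : D ⟶ hom k X.as N := ε ≫ preMap f N
    have e₁ : φ f = φ g := (hD _ _).unique (y₁ := φ f) (y₂ := φ g) hfg rfl
    apply Underlying.hom_ext
    apply (hε X.as 0).1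
    refine CochainComplex.HomComplex.Cochain.ext _ _ fun p q hpq => ?_
    refine ModuleCat.hom_ext (LinearMap.ext fun x => ?_)
    obtain rfl : p = q := by omega
    rw [key, key]
    congr 1
    exact LinearMap.congr_fun (congrArg (fun t => ModuleCat.Hom.hom
      (HomologicalComplex.Hom.f t p)) e₁) x

/-- Colimits in the underlying category of a cotensored dg category have the universal property
for morphisms of any degree. -/
lemma IsCotensored.exists_desc_of_isColimit (h : IsCotensored k M) {J : Type*} [Category J]
    {F : J ⥤ Underlying k M} {c : Cocone F} (hc : IsColimit c) {N : M} {n : ℤ}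
    (g : ∀ j, (hom k (F.obj j).as N).X n) (hg : ∀ ⦃i j⦄ (f : i ⟶ j), pre (F.map f) (g j) = g i) :
    ∃ t : (hom k c.pt.as N).X n, ∀ j, pre (c.ι.app j) t = g j := by
  obtain ⟨Q, ε, lift, ext⟩ := h.exists_classifier N n
  choose l hl using fun j => lift (g j)
  let c' : Cocone F := ⟨Q, { app := l, naturality := fun i j f => ext (by
    rw [pre_comp, hl, hg]; exact ((pre_comp (l i) (𝟙 Q) ε).trans ((congrArg (pre (l i)) (pre_id ε)).trans (hl i))).symm) }⟩
  refine ⟨pre (hc.desc c') ε, fun j => ?_⟩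
  rw [← pre_comp, hc.fac]
  exact hl j

lemma IsCotensored.ext_of_isColimit (h : IsCotensored k M) {J : Type*} [Category J]
    {F : J ⥤ Underlying k M} {c : Cocone F} (hc : IsColimit c) {N : M} {n : ℤ}
    {t t' : (hom k c.pt.as N).X n} (ht : ∀ j, pre (c.ι.app j) t = pre (c.ι.app j) t') :
    t = t' := by
  obtain ⟨Q, ε, lift, ext⟩ := h.exists_classifier N n
  obtain ⟨f, rfl⟩ := lift t
  obtain ⟨f', rfl⟩ := lift t'
  refine congrArg (fun s => pre s ε) ?_
  refine hc.hom_ext fun j => ext ?_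
  rw [pre_comp, pre_comp, ht]

/-! # Enriched cell attachments -/

variable (k) in
/-- The source component of a morphism of arrows. -/
def leftHom (x y : Arrow (Underlying k M)) (n : ℤ) :
    (hom k x y).X n →ₗ[k] (hom k x.left.as y.left.as).X n :=
  (LinearMap.fst k _ _).comp (arrowHom x y n).subtype

variable (k) in
/-- The target component of a morphism of arrows. -/
def rightHom (x y : Arrow (Underlying k M)) (n : ℤ) :
    (hom k x y).X n →ₗ[k] (hom k x.right.as y.right.as).X n :=
  (LinearMap.snd k _ _).comp (arrowHom x y n).subtype

section

variable {x y z : Arrow (Underlying k M)}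

lemma d_leftHom (i j : ℤ) (s : (hom k x y).X i) :
    ((hom k x.left.as y.left.as).d i j).hom (leftHom k x y i s) =
      leftHom k x y j (((hom k x y).d i j).hom s) := rfl

lemma d_rightHom (i j : ℤ) (s : (hom k x y).X i) :
    ((hom k x.right.as y.right.as).d i j).hom (rightHom k x y i s) =
      rightHom k x y j (((hom k x y).d i j).hom s) := rfl

lemma leftHom_comp {p q n : ℤ} (h : p + q = n) (s : (hom k x y).X p) (t : (hom k y z).X q) :
    leftHom k x z n (comp p q n h s t) = comp p q n h (leftHom k x y p s) (leftHom k y z q t) :=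
  rfl

lemma rightHom_comp {p q n : ℤ} (h : p + q = n) (s : (hom k x y).X p) (t : (hom k y z).X q) :
    rightHom k x z n (comp p q n h s t) =
      comp p q n h (rightHom k x y p s) (rightHom k y z q t) :=
  rfl

lemma pre_rightHom {n : ℤ} (s : (hom k x y).X n) :
    pre x.hom (rightHom k x y n s) = post y.hom (leftHom k x y n s) := s.2

/-- A commutative square of degree `n`, as a morphism of arrows. -/
def mkHom {n : ℤ} (a : (hom k x.left.as y.left.as).X n) (b : (hom k x.right.as y.right.as).X n)
    (h : pre x.hom b = post y.hom a) : (hom k x y).X n :=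
  (⟨(a, b), h⟩ : arrowHom x y n)

lemma arrowHom_ext {n : ℤ} {s t : (hom k x y).X n} (h₁ : leftHom k x y n s = leftHom k x y n t)
    (h₂ : rightHom k x y n s = rightHom k x y n t) : s = t :=
  Subtype.ext (Prod.ext h₁ h₂)

end

/-- The universal way to solve all lifting problems, of all degrees, of the arrows `I i` against
the arrow `x`. -/
structure CellAttachment {ι : Type*} (I : ι → Arrow (Underlying k M))
    (x : Arrow (Underlying k M)) where
  obj : Underlying k M
  inl : x.left ⟶ obj
  cell (i : ι) : hom k (I i) x ⟶ hom k (I i).right.as obj.as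
  w (i : ι) (n : ℤ) (s : (hom k (I i) x).X n) :
    pre (I i).hom (((cell i).f n).hom s) = post inl (leftHom k _ _ n s)
  -- The families `b` are merely graded and need not commute with differentials. This is the
  -- universal property of the full Hom complex, needed to make the attachment a dg functor;
  -- `descClosed` is its closed version.
  desc {N : M} {n : ℤ} (g : (hom k x.left.as N).X n)
    (b : ∀ i p q (_ : p + n = q), (hom k (I i) x).X p →ₗ[k] (hom k (I i).right.as N).X q)
    (hb : ∀ i p q h s, pre (I i).hom (b i p q h s) = comp p n q h (leftHom k _ _ p s) g) :
    ∃ t : (hom k obj.as N).X n, pre inl t = g ∧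
      ∀ i p q h s, comp p n q h (((cell i).f p).hom s) t = b i p q h s
  ext {N : M} {n : ℤ} {t t' : (hom k obj.as N).X n} (h₁ : pre inl t = pre inl t')
    (h₂ : ∀ i p q (h : p + n = q) s, comp p n q h (((cell i).f p).hom s) t =
      comp p n q h (((cell i).f p).hom s) t') : t = t'
  descClosed {N : Underlying k M} (g : x.left ⟶ N)
    (b : ∀ i, hom k (I i) x ⟶ hom k (I i).right.as N.as)
    (hb : ∀ i n s, pre (I i).hom (((b i).f n).hom s) = post g (leftHom k _ _ n s)) :
    ∃ t : obj ⟶ N, inl ≫ t = g ∧ ∀ i n s, post t (((cell i).f n).hom s) = ((b i).f n).hom s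

/-- The attachment is the pushout of `x.left ⟵ ∐ A_i ⊙ H_i ⟶ ∐ B_i ⊙ H_i`, with `H_i` the complex of
squares from `I i` to `x`. The ordinary pushout has the universal property in degree `n` because
classifiers convert morphisms of degree `n` into closed ones. -/
lemma IsBicomplete.nonempty_cellAttachment (hbi : IsBicomplete k M) {ι : Type v}
    (I : ι → Arrow (Underlying k M)) (x : Arrow (Underlying k M)) :
    Nonempty (CellAttachment I x) := by
  have := hbi.hasColimits
  choose PA ηA hA using fun i => hbi.tensored.exists_tensor (hom k (I i) x) (I i).left.as
  choose PB ηB hB using fun i => hbi.tensored.exists_tensor (hom k (I i) x) (I i).right.as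
  let lc (i : ι) : hom k (I i) x ⟶ hom k (I i).left.as x.left.as :=
    { f := fun n => ModuleCat.ofHom (leftHom k _ _ n) }
  -- `κ i` is `I i` tensored with the complex of squares, and `φ i` evaluates a square at its source
  -- component.
  choose κ hκ using fun i => (hA i).descClosed (ηB i ≫ preMap (I i).hom (PB i).as)
  choose φ hφ using fun i => (hA i).descClosed (lc i)
  replace hκ : ∀ i p s, post (κ i) (((ηA i).f p).hom s) = pre (I i).hom (((ηB i).f p).hom s) := hκ
  replace hφ : ∀ i p s, post (φ i) (((ηA i).f p).hom s) = leftHom k _ _ p s := hφ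
  let φ' : (∐ PA) ⟶ x.left := Sigma.desc φ
  let κ' : (∐ PA) ⟶ ∐ PB := Sigma.desc (fun i => κ i ≫ Sigma.ι PB i)
  let inl : x.left ⟶ pushout φ' κ' := pushout.inl φ' κ'
  let j (i : ι) : PB i ⟶ pushout φ' κ' := Sigma.ι PB i ≫ pushout.inr φ' κ'
  have hj : ∀ i, κ i ≫ j i = φ i ≫ inl := by
    intro i
    have := Sigma.ι PA i ≫= (pushout.condition (f := φ') (g := κ'))
    simpa [φ', κ', j, inl] using this.symm
  have exists_desc : ∀ {N : Underlying k M} (g : x.left ⟶ N) (b : ∀ i, PB i ⟶ N)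
      (_ : ∀ i, φ i ≫ g = κ i ≫ b i), ∃ t : pushout φ' κ' ⟶ N, inl ≫ t = g ∧ ∀ i, j i ≫ t = b i := by
    intro N g b h
    refine ⟨pushout.desc g (Sigma.desc b) (Sigma.hom_ext _ _ fun i => ?_), ?_, fun i => ?_⟩
    · simpa [φ', κ'] using h i
    · exact pushout.inl_desc _ _ _
    · rw [Category.assoc, pushout.inr_desc, Sigma.ι_desc]
  have hom_ext : ∀ {N : Underlying k M} (t t' : pushout φ' κ' ⟶ N), inl ≫ t = inl ≫ t' →
      (∀ i, j i ≫ t = j i ≫ t') → t = t' := by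
    intro N t t' h₁ h₂
    refine pushout.hom_ext h₁ (Sigma.hom_ext _ _ fun i => ?_)
    simpa [j] using h₂ i
  refine ⟨⟨pushout φ' κ', inl, fun i => ηB i ≫ postMap _ (j i), ?_, ?_, ?_, ?_⟩⟩
  · intro i n s
    change pre (I i).hom (post (j i) (((ηB i).f n).hom s)) = _
    rw [← post_pre, ← hκ, ← post_comp, hj, post_comp, hφ]
  · intro N n g b hb
    obtain ⟨Q, ε, lift, ext⟩ := hbi.cotensored.exists_classifier N n
    obtain ⟨g', hg'⟩ := lift g
    choose b' hb' using fun i => (hB i).desc (b i)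
    choose c hc using fun i => lift (b' i)
    obtain ⟨t, ht, ht'⟩ := exists_desc g' c (fun i => ext ((hA i).ext fun p q h s => by
      rw [pre_comp, pre_comp, hg', hc, comp_pre_right, comp_pre_right, hφ, hκ, comp_pre, hb', hb]))
    refine ⟨pre t ε, ?_, fun i p q h s => ?_⟩
    · rw [← pre_comp, ht, hg']
    · change comp p n q h (post (j i) (((ηB i).f p).hom s)) (pre t ε) = _
      rw [← comp_pre_right, ← pre_comp, ht', hc, hb']
  · intro N n t t' h₁ h₂
    obtain ⟨Q, ε, lift, ext⟩ := hbi.cotensored.exists_classifier N n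
    obtain ⟨f, rfl⟩ := lift t
    obtain ⟨f', rfl⟩ := lift t'
    refine congrArg (fun s => pre s ε) ?_
    refine hom_ext _ _ (ext ?_) fun i => ext ((hB i).ext fun p q h s => ?_)
    · rw [pre_comp, pre_comp, h₁]
    · rw [pre_comp (j i) f, pre_comp (j i) f', comp_pre_right h _ (j i), comp_pre_right h _ (j i)]
      exact h₂ i p q h s
  · intro N g b hb
    choose c hc using fun i => (hB i).descClosed (b i)
    obtain ⟨t, ht, ht'⟩ := exists_desc g c (fun i => Underlying.hom_ext ((hA i).ext
      fun p q h s => by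
        obtain rfl : p = q := by omega
        change post (φ i ≫ g) _ = post (κ i ≫ c i) _
        rw [post_comp, post_comp, hφ, hκ, post_pre, hc, hb]))
    refine ⟨t, ht, fun i n s => ?_⟩
    change post t (post (j i) (((ηB i).f n).hom s)) = _
    rw [← post_comp, ht', hc]

end

end DGCategory
-- Functoriality and lifting properties of cell attachments, and colimits of partial factorizations.
namespace DGCategory

section

variable {k : Type v} [CommRing k] {M : Type u} [DGCategory k M]

namespace CellAttachment

variable {ι : Type*} {I : ι → Arrow (Underlying k M)} (C : ∀ x, CellAttachment I x)

/-- The functoriality of cell attachments, as a relation. -/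
noncomputable def functorialRelation :
    FunctorialRelation k (fun x : Arrow (Underlying k M) => (C x).obj.as) where
  -- The map induced by `s` restricts to the source component of `s` and sends the cell labelled by
  -- `z` to the cell labelled by `z` followed by `s`.
  rel {x y} n s t := pre (C x).inl t = post (C y).inl (leftHom k x y n s) ∧
    ∀ i p q (h : p + n = q) (z : (hom k (I i) x).X p),
      comp p n q h ((((C x).cell i).f p).hom z) t =
        (((C y).cell i).f q).hom (comp p n q h z s)
  ex {x y} n s := (C x).desc (post (C y).inl (leftHom k x y n s))
    (fun i p q h => (((C y).cell i).f q).hom.comp ((comp p n q h).flip s)) (by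
      intro i p q h z
      rw [comp_post, ← leftHom_comp, LinearMap.comp_apply, (C y).w]
      rfl)
  uniq h h' := (C _).ext (h.1.trans h'.1.symm)
    (fun i p q e z => (h.2 i p q e z).trans (h'.2 i p q e z).symm)
  add h h' := ⟨by rw [map_add, map_add, map_add, h.1, h'.1], fun i p q e z => by
    rw [map_add, map_add, map_add, h.2, h'.2]⟩
  smul c _ _ h := ⟨by rw [map_smul, map_smul, map_smul, h.1], fun i p q e z => by
    rw [map_smul, map_smul, map_smul, h.2]⟩
  d {x y n s t} h := ⟨by rw [← d_pre, h.1, d_post, d_leftHom], fun i p q e z => by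
    -- The relation for `d s` in total degree `q + 1` is found by differentiating the one for `s` in
    -- total degree `q` and cancelling the terms that contain `d z`.
    obtain ⟨q, rfl⟩ : ∃ q', q = q' + 1 := ⟨q - 1, by omega⟩
    have e' : p + n = q := by omega
    have h₁ := d_comp' p n q (p + 1) (n + 1) (q + 1) e' rfl rfl rfl
      ((((C x).cell i).f p).hom z) t
    have h₂ := d_comp' p n q (p + 1) (n + 1) (q + 1) e' rfl rfl rfl z s
    rw [h.2, comm_apply, h₂, comm_apply, h.2, map_add, LinearMap.map_smul_of_tower] at h₁
    exact (add_right_cancel h₁).symm⟩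
  id x := ⟨(DGCategory.comp_id 0 _).trans (DGCategory.id_comp 0 _).symm, fun i p q e z => by
    obtain rfl : p = q := by omega
    rw [DGCategory.comp_id, DGCategory.comp_id]⟩
  comp {x y z} p q n h {s s' t t'} e e' := ⟨by
      rw [← comp_pre, e.1, ← comp_pre_right, e'.1, comp_post, leftHom_comp],
    fun i a b hab w => by
      rw [← DGCategory.assoc a p q (a + p) n b rfl h (by omega) hab, e.2, e'.2,
        DGCategory.assoc a p q (a + p) n b rfl h (by omega) hab]⟩

/-- The dg functor sending an arrow to the target of the universal cell attachment. -/
noncomputable def functor : DGFunctor k (Arrow (Underlying k M)) M :=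
  (functorialRelation C).functor

variable {x y : Arrow (Underlying k M)} {n : ℤ} (s : (hom k x y).X n)

/-- The action on morphisms of the cell attachment dg functor. -/
noncomputable def mapHom : (hom k (C x).obj.as (C y).obj.as).X n :=
  (((functor C).map x y).f n).hom s

variable {C}

lemma pre_inl_map : pre (C x).inl (mapHom C s) =
    post (C y).inl (leftHom k x y n s) :=
  ((functorialRelation C).rel_map n s).1

lemma cell_comp_map (i : ι) (p q : ℤ) (h : p + n = q) (z : (hom k (I i) x).X p) :
    comp p n q h ((((C x).cell i).f p).hom z) (mapHom C s) =
      (((C y).cell i).f q).hom (comp p n q h z s) :=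
  ((functorialRelation C).rel_map n s).2 i p q h z

/-- The target components of the morphisms of arrows, as a map of complexes. -/
noncomputable def rightMap (x y : Arrow (Underlying k M)) :
    hom k x y ⟶ hom k x.right.as y.right.as where
  f n := ModuleCat.ofHom (rightHom k x y n)

lemma exists_proj (A : CellAttachment I x) : ∃ π : A.obj ⟶ x.right, A.inl ≫ π = x.hom ∧
    ∀ i n s, post π (((A.cell i).f n).hom s) = rightHom k (I i) x n s :=
  A.descClosed x.hom (fun i => rightMap (I i) x) (fun _ _ s => pre_rightHom s)

/-- The projection to the target of the arrow. -/
noncomputable def proj (A : CellAttachment I x) : A.obj ⟶ x.right := A.exists_proj.choose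

lemma inl_proj (A : CellAttachment I x) : A.inl ≫ A.proj = x.hom := A.exists_proj.choose_spec.1

lemma post_proj_cell (A : CellAttachment I x) (i : ι) (n : ℤ) (s : (hom k (I i) x).X n) :
    post A.proj (((A.cell i).f n).hom s) = rightHom k (I i) x n s :=
  A.exists_proj.choose_spec.2 i n s

lemma proj_naturality : pre (C x).proj (rightHom k x y n s) =
    post (C y).proj (mapHom C s) := by
  apply (C x).ext
  · rw [← post_pre, pre_inl_map, ← pre_comp, ← post_comp, inl_proj, inl_proj, pre_rightHom]
  · intro i p q h z
    rw [comp_pre_right, comp_post, cell_comp_map, post_proj_cell, post_proj_cell, rightHom_comp]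

/-- A closed commutative square of degree zero has a lift into the cell attachment. -/
lemma exists_lift (A : CellAttachment I x) (i : ι) (a : (I i).left ⟶ x.left)
    (b : (I i).right ⟶ x.right) (h : (I i).hom ≫ b = a ≫ x.hom) :
    ∃ l : (I i).right ⟶ A.obj, (I i).hom ≫ l = a ≫ A.inl ∧ l ≫ A.proj = b := by
  -- The square is a cocycle of degree zero, and the cell that it labels is the lift.
  let s : (hom k (I i) x).X 0 := mkHom (ClosedHom.val a) (ClosedHom.val b) (congrArg ClosedHom.val h)
  have hs : ((hom k (I i) x).d 0 1).hom s = 0 := arrowHom_ext a.closed b.closed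
  refine ⟨⟨((A.cell i).f 0).hom s, ?_⟩, Underlying.hom_ext (A.w i 0 s),
    Underlying.hom_ext (A.post_proj_cell i 0 s)⟩
  rw [comm_apply, hs, map_zero]

end CellAttachment

/-- Attaching cells of a class stable under shifts and identity cones gives morphisms with the
left lifting property. -/
lemma CellAttachment.llp_inl {k : Type v} [Field k] {M : Type u} [DGCategory k M]
    (hM : IsStronglyPretriangulated k M) {W : MorphismProperty (Underlying k M)}
    (hW : hM.Stable W) {ι : Type*} {I : ι → Arrow (Underlying k M)} (hI : ∀ i, W (I i).hom)
    {x : Arrow (Underlying k M)} (A : CellAttachment I x) : W.rlp.llp A.inl := by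
  intro X Y p hp
  refine ⟨fun {g h} sq => ?_⟩
  -- Pasting a square from `I i` to `x` with the given square gives a square from `I i` to `p`. The
  -- choice of lifts is linear and commutes with differentials, so it defines a closed map on the
  -- attached cells.
  let b (i : ι) : hom k (I i) x ⟶ arrowHomComplex (Arrow.mk (I i).hom) (Arrow.mk p) :=
    { f := fun n => ModuleCat.ofHom (LinearMap.codRestrict (arrowHom _ _ n)
        (((post g).comp (leftHom k (I i) x n)).prod ((post h).comp ((A.cell i).f n).hom))
        (fun (s : (hom k (I i) x).X n) => by
          change pre (I i).hom (post h (((A.cell i).f n).hom s)) =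
            post p (post g (leftHom k (I i) x n s))
          rw [← post_pre, A.w, ← post_comp, ← post_comp, sq.w]))
      comm' := fun m n _ => by
        apply ModuleCat.hom_ext
        refine LinearMap.ext fun s => Subtype.ext (Prod.ext ?_ ?_)
        · exact (d_post g m n _).trans (congrArg (post g) (d_leftHom m n s))
        · exact (d_post h m n _).trans (congrArg (post h) (comm_apply (A.cell i) m n s)) }
  choose l hl using fun i => exists_enriched_lift hM hW (I i).hom (hI i) p hp (b i)
  obtain ⟨t, ht, ht'⟩ := A.descClosed g l (fun i n s => (hl i n s).1)
  -- The lower triangle is checked on `x.left` and on each cell separately.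
  refine ⟨⟨⟨t, ht, Underlying.hom_ext (A.ext ?_ ?_)⟩⟩⟩
  · change ClosedHom.val (A.inl ≫ t ≫ p) = ClosedHom.val (A.inl ≫ h)
    rw [← Category.assoc, ht, sq.w]
  · intro i m n e s
    obtain rfl : m = n := by omega
    change post (t ≫ p) _ = post h _
    rw [post_comp, ht']
    exact (hl i m s).2

/-! # Partial enriched factorizations -/

variable (k M) in
/-- A dg functor `f ↦ mid f` with a dg natural projection to the target of `f`, such that all the
objects `mid f` are exhibited as retracts. -/
structure PartialFactorization where
  mid : DGFunctor k (Arrow (Underlying k M)) M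
  R (f : Arrow (Underlying k M)) : Underlying.of (mid.obj f) ⟶ f.right
  R_naturality {f g : Arrow (Underlying k M)} {n : ℤ} (s : (hom k f g).X n) :
    pre (R f) (rightHom k f g n s) = post (R g) (((mid.map f g).f n).hom s)
  -- Smallness will be applied to sequences of these objects, not of the middle objects. No
  -- functoriality in `f` is required of them.
  big (f : Arrow (Underlying k M)) : Underlying k M
  sec (f : Arrow (Underlying k M)) : Underlying.of (mid.obj f) ⟶ big f
  ret (f : Arrow (Underlying k M)) : big f ⟶ Underlying.of (mid.obj f)
  sec_ret (f : Arrow (Underlying k M)) : sec f ≫ ret f = 𝟙 _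

namespace PartialFactorization

/-- Morphisms of partial enriched factorizations. -/
@[ext]
structure Hom (E E' : PartialFactorization k M) where
  app (f : Arrow (Underlying k M)) : Underlying.of (k := k) (E.mid.obj f) ⟶ .of (E'.mid.obj f)
  big (f : Arrow (Underlying k M)) : E.big f ⟶ E'.big f
  naturality {f g : Arrow (Underlying k M)} {n : ℤ} (s : (hom k f g).X n) :
    pre (app f) (((E'.mid.map f g).f n).hom s) = post (app g) (((E.mid.map f g).f n).hom s)
  app_R (f : Arrow (Underlying k M)) : app f ≫ E'.R f = E.R f
  sec_big (f : Arrow (Underlying k M)) : E.sec f ≫ big f = app f ≫ E'.sec f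
  big_ret (f : Arrow (Underlying k M)) : big f ≫ E'.ret f = E.ret f ≫ app f

instance : Category (PartialFactorization k M) where
  Hom := Hom
  id E :=
    { app := fun f => 𝟙 _
      big := fun f => 𝟙 _
      naturality := fun s => by rw [pre_id, post_id]
      app_R := fun f => Category.id_comp _
      sec_big := fun f => by rw [Category.comp_id, Category.id_comp]
      big_ret := fun f => by rw [Category.comp_id, Category.id_comp] }
  comp {E E' E''} α β :=
    { app := fun f => α.app f ≫ β.app f
      big := fun f => α.big f ≫ β.big f
      naturality := fun s => by
        rw [pre_comp, β.naturality, ← post_pre, α.naturality, post_comp]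
      app_R := fun f => by rw [Category.assoc, β.app_R, α.app_R]
      sec_big := fun f => by
        rw [← Category.assoc, α.sec_big, Category.assoc, β.sec_big, Category.assoc]
      big_ret := fun f => by
        rw [Category.assoc, β.big_ret, ← Category.assoc, α.big_ret, Category.assoc] }
  id_comp α := Hom.ext (funext fun _ => Category.id_comp _) (funext fun _ => Category.id_comp _)
  comp_id α := Hom.ext (funext fun _ => Category.comp_id _) (funext fun _ => Category.comp_id _)
  assoc α β γ := Hom.ext (funext fun _ => Category.assoc _ _ _)
    (funext fun _ => Category.assoc _ _ _)

@[ext]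
lemma hom_ext {E E' : PartialFactorization k M} {α β : E ⟶ E'} (h : ∀ f, α.app f = β.app f)
    (h' : ∀ f, α.big f = β.big f) : α = β :=
  Hom.ext (funext h) (funext h')

/-- Evaluation of the middle object at an arrow. -/
@[simps]
def evMid (f : Arrow (Underlying k M)) : PartialFactorization k M ⥤ Underlying k M where
  obj E := .of (E.mid.obj f)
  map α := α.app f

/-- Evaluation of the big object at an arrow. -/
@[simps]
def evBig (f : Arrow (Underlying k M)) : PartialFactorization k M ⥤ Underlying k M where
  obj E := E.big f
  map α := α.big f

section

variable [HasColimits (Underlying k M)] (hco : IsCotensored k M)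
  {J : Type v} [Category.{v} J] (F : J ⥤ PartialFactorization k M)

/-- The colimit of the middle objects at an arrow. -/
noncomputable def colimitMid (f : Arrow (Underlying k M)) : Underlying k M := colimit (F ⋙ evMid f)

/-- The colimit of the big objects at an arrow. -/
noncomputable def colimitBig (f : Arrow (Underlying k M)) : Underlying k M := colimit (F ⋙ evBig f)

variable (f : Arrow (Underlying k M))

/-- The inclusion of a middle object in the colimit. -/
noncomputable def ιMid (j : J) : Underlying.of ((F.obj j).mid.obj f) ⟶ colimitMid F f :=
  colimit.ι (F ⋙ evMid f) j

/-- The inclusion of a big object in the colimit. -/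
noncomputable def ιBig (j : J) : (F.obj j).big f ⟶ colimitBig F f :=
  colimit.ι (F ⋙ evBig f) j

variable {F f}

lemma map_ιMid {i j : J} (φ : i ⟶ j) : (F.map φ).app f ≫ ιMid F f j = ιMid F f i :=
  colimit.w (F ⋙ evMid f) φ

lemma map_ιBig {i j : J} (φ : i ⟶ j) : (F.map φ).big f ≫ ιBig F f j = ιBig F f i :=
  colimit.w (F ⋙ evBig f) φ

lemma exists_descMid {X : Underlying k M} (g : ∀ j, Underlying.of ((F.obj j).mid.obj f) ⟶ X)
    (hg : ∀ ⦃i j : J⦄ (φ : i ⟶ j), (F.map φ).app f ≫ g j = g i) :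
    ∃ t : colimitMid F f ⟶ X, ∀ j, ιMid F f j ≫ t = g j :=
  ⟨colimit.desc (F ⋙ evMid f) ⟨X, { app := g
                                    naturality := fun _ _ φ =>
                                      (hg φ).trans (Category.comp_id _).symm }⟩,
    fun _ => colimit.ι_desc _ _⟩

lemma exists_descBig {X : Underlying k M} (g : ∀ j, (F.obj j).big f ⟶ X)
    (hg : ∀ ⦃i j : J⦄ (φ : i ⟶ j), (F.map φ).big f ≫ g j = g i) :
    ∃ t : colimitBig F f ⟶ X, ∀ j, ιBig F f j ≫ t = g j :=
  ⟨colimit.desc (F ⋙ evBig f) ⟨X, { app := g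
                                    naturality := fun _ _ φ =>
                                      (hg φ).trans (Category.comp_id _).symm }⟩,
    fun _ => colimit.ι_desc _ _⟩

lemma colimitMid_ext {X : Underlying k M} {t t' : colimitMid F f ⟶ X}
    (h : ∀ j, ιMid F f j ≫ t = ιMid F f j ≫ t') : t = t' :=
  colimit.hom_ext h

lemma colimitBig_ext {X : Underlying k M} {t t' : colimitBig F f ⟶ X}
    (h : ∀ j, ιBig F f j ≫ t = ιBig F f j ≫ t') : t = t' :=
  colimit.hom_ext h

include hco in
lemma exists_descMid_degree {X : M} {n : ℤ} (g : ∀ j, (hom k ((F.obj j).mid.obj f) X).X n)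
    (hg : ∀ ⦃i j : J⦄ (φ : i ⟶ j), pre ((F.map φ).app f) (g j) = g i) :
    ∃ t : (hom k (colimitMid F f).as X).X n, ∀ j, pre (ιMid F f j) t = g j :=
  hco.exists_desc_of_isColimit (colimit.isColimit (F ⋙ evMid f)) g hg

include hco in
lemma colimitMid_ext_degree {X : M} {n : ℤ} {t t' : (hom k (colimitMid F f).as X).X n}
    (h : ∀ j, pre (ιMid F f j) t = pre (ιMid F f j) t') : t = t' :=
  hco.ext_of_isColimit (colimit.isColimit (F ⋙ evMid f)) h

variable (F)

/-- The functoriality of the colimit of the middle objects, as a relation. -/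
noncomputable def colimitRelation :
    FunctorialRelation k (fun f : Arrow (Underlying k M) => (colimitMid F f).as) where
  rel {f g} n s t := ∀ j, pre (ιMid F f j) t =
    post (ιMid F g j) ((((F.obj j).mid.map f g).f n).hom s)
  ex {f g} n s := exists_descMid_degree hco _ (fun i j φ => by
    rw [← map_ιMid φ, post_comp, ← post_pre, (F.map φ).naturality])
  uniq h h' := colimitMid_ext_degree hco (fun j => (h j).trans (h' j).symm)
  add h h' j := by rw [map_add, map_add, map_add, h, h']
  smul c _ _ h j := by rw [map_smul, map_smul, map_smul, h]
  d h j := by rw [← d_pre, h, d_post, comm_apply]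
  id f j := by
    rw [(F.obj j).mid.map_id]
    exact (DGCategory.comp_id 0 _).trans (DGCategory.id_comp 0 _).symm
  comp p q n e _ _ _ _ h h' j := by
    rw [← comp_pre, h, ← comp_pre_right, h', comp_post, (F.obj j).mid.map_comp p q n e]

/-- The action on morphisms of the colimit of partial enriched factorizations. -/
noncomputable def colimitMapHom {f g : Arrow (Underlying k M)} {n : ℤ} (s : (hom k f g).X n) :
    (hom k (colimitMid F f).as (colimitMid F g).as).X n :=
  (((colimitRelation hco F).functor.map f g).f n).hom s

lemma pre_ιMid_colimitMapHom {f g : Arrow (Underlying k M)} {n : ℤ} (s : (hom k f g).X n) (j : J) :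
    pre (ιMid F f j) (colimitMapHom hco F s) =
      post (ιMid F g j) ((((F.obj j).mid.map f g).f n).hom s) :=
  (colimitRelation hco F).rel_map n s j

lemma exists_colimitR (f : Arrow (Underlying k M)) : ∃ t : colimitMid F f ⟶ f.right,
    ∀ j, ιMid F f j ≫ t = (F.obj j).R f :=
  exists_descMid _ (fun _ _ φ => (F.map φ).app_R f)

lemma exists_colimitSec (f : Arrow (Underlying k M)) : ∃ t : colimitMid F f ⟶ colimitBig F f,
    ∀ j, ιMid F f j ≫ t = (F.obj j).sec f ≫ ιBig F f j :=
  exists_descMid _ (fun _ _ φ => by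
    rw [← Category.assoc, ← (F.map φ).sec_big, Category.assoc, map_ιBig])

lemma exists_colimitRet (f : Arrow (Underlying k M)) : ∃ t : colimitBig F f ⟶ colimitMid F f,
    ∀ j, ιBig F f j ≫ t = (F.obj j).ret f ≫ ιMid F f j :=
  exists_descBig _ (fun _ _ φ => by
    rw [← Category.assoc, (F.map φ).big_ret, Category.assoc, map_ιMid])

include hco in
-- Colimits are formed arrow by arrow, separately on middle and big objects. The sections,
-- retractions and projections pass to the colimit because morphisms commute with them; the dg
-- functoriality does because ordinary colimits are dg colimits.
lemma exists_colimitCocone : ∃ c : Cocone F, Nonempty (IsColimit c) ∧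
    (∀ f, Nonempty (IsColimit ((evMid f).mapCocone c))) ∧
    ∀ f, Nonempty (IsColimit ((evBig f).mapCocone c)) := by
  choose R hR using exists_colimitR F
  choose S hS using exists_colimitSec F
  choose T hT using exists_colimitRet F
  have hST : ∀ f, S f ≫ T f = 𝟙 (colimitMid F f) := fun f => colimitMid_ext fun j => by
    rw [← Category.assoc, hS, Category.assoc, hT, ← Category.assoc, (F.obj j).sec_ret,
      Category.id_comp, Category.comp_id]
  let E : PartialFactorization k M :=
    { mid := (colimitRelation hco F).functor
      R := R
      R_naturality := fun {f g n} s => by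
        change pre (R f) _ = post (R g) (colimitMapHom hco F s)
        refine colimitMid_ext_degree hco fun j => ?_
        rw [← pre_comp, hR, ← post_pre, pre_ιMid_colimitMapHom, ← post_comp, hR,
          (F.obj j).R_naturality]
      big := colimitBig F
      sec := S
      ret := T
      sec_ret := hST }
  let ι (j : J) : F.obj j ⟶ E :=
    { app := fun f => ιMid F f j
      big := fun f => ιBig F f j
      naturality := fun s => pre_ιMid_colimitMapHom hco F s j
      app_R := fun f => hR f j
      sec_big := fun f => (hS f j).symm
      big_ret := fun f => hT f j }
  let c : Cocone F := ⟨E, { app := ι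
                            naturality := fun i j φ => (hom_ext (fun f => map_ιMid φ)
                              (fun f => map_ιBig φ)).trans (Category.comp_id _).symm }⟩
  have exists_desc : ∀ c' : Cocone F, ∃ t : E ⟶ c'.pt, ∀ j, ι j ≫ t = c'.ι.app j := by
    intro c'
    have hc' : ∀ ⦃i j⦄ (φ : i ⟶ j), F.map φ ≫ c'.ι.app j = c'.ι.app i := fun i j φ => c'.w φ
    have hc₁ : ∀ ⦃i j⦄ (φ : i ⟶ j) f, (F.map φ).app f ≫ (c'.ι.app j).app f = (c'.ι.app i).app f :=
      fun i j φ f => congrArg (fun α => Hom.app α f) (hc' φ)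
    have hc₂ : ∀ ⦃i j⦄ (φ : i ⟶ j) f, (F.map φ).big f ≫ (c'.ι.app j).big f = (c'.ι.app i).big f :=
      fun i j φ f => congrArg (fun α => Hom.big α f) (hc' φ)
    choose t ht using fun f => exists_descMid (F := F) (X := .of (c'.pt.mid.obj f)) (fun j => (c'.ι.app j).app f)
      (fun i j φ => hc₁ φ f)
    choose u hu using fun f => exists_descBig (F := F) (X := c'.pt.big f) (fun j => (c'.ι.app j).big f)
      (fun i j φ => hc₂ φ f)
    have h₁ : ∀ f, t f ≫ c'.pt.R f = R f := fun f => colimitMid_ext fun j => by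
      rw [← Category.assoc, ht, hR]
      exact (c'.ι.app j).app_R f
    have h₂ : ∀ f, S f ≫ u f = t f ≫ c'.pt.sec f := fun f => colimitMid_ext fun j => by
      rw [← Category.assoc, hS, Category.assoc, hu, ← Category.assoc, ht]
      exact (c'.ι.app j).sec_big f
    have h₃ : ∀ f, u f ≫ c'.pt.ret f = T f ≫ t f := fun f => colimitBig_ext fun j => by
      rw [← Category.assoc, hu, ← Category.assoc, hT, Category.assoc, ht]
      exact (c'.ι.app j).big_ret f
    refine ⟨
      { app := t
        big := u
        naturality := fun {f g n} s => by
          change pre (t f) _ = post (t g) (colimitMapHom hco F s)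
          refine colimitMid_ext_degree hco fun j => ?_
          rw [← pre_comp, ht, ← post_pre, pre_ιMid_colimitMapHom, ← post_comp, ht]
          exact (c'.ι.app j).naturality s
        app_R := h₁
        sec_big := h₂
        big_ret := h₃ }, fun j => hom_ext (fun f => ht f j) (fun f => hu f j)⟩
  choose desc hdesc using exists_desc
  refine ⟨c, ⟨⟨desc, hdesc, fun c' m hm => hom_ext (fun f => colimitMid_ext fun j => ?_)
    (fun f => colimitBig_ext fun j => ?_)⟩⟩, fun f => ⟨?_⟩, fun f => ⟨?_⟩⟩
  · exact congrArg (fun α => Hom.app α f) ((hm j).trans (hdesc c' j).symm)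
  · exact congrArg (fun α => Hom.big α f) ((hm j).trans (hdesc c' j).symm)
  · exact IsColimit.ofIsoColimit (colimit.isColimit (F ⋙ evMid f))
      (Cocone.ext (Iso.refl _) fun j => Category.comp_id (ιMid F f j))
  · exact IsColimit.ofIsoColimit (colimit.isColimit (F ⋙ evBig f))
      (Cocone.ext (Iso.refl _) fun j => Category.comp_id (ιBig F f j))

include hco

lemma hasColimits : HasColimitsOfSize.{v, v} (PartialFactorization k M) :=
  ⟨fun _ _ => ⟨fun F => by
    obtain ⟨c, ⟨hc⟩, -⟩ := exists_colimitCocone hco F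
    exact ⟨⟨c, hc⟩⟩⟩⟩

lemma preservesColimits_evMid (f : Arrow (Underlying k M)) :
    PreservesColimitsOfSize.{v, v} (evMid (k := k) f) :=
  ⟨⟨fun {F} => by
    obtain ⟨c, ⟨hc⟩, h, -⟩ := exists_colimitCocone hco F
    exact preservesColimit_of_preserves_colimit_cocone hc (h f).some⟩⟩

lemma preservesColimits_evBig (f : Arrow (Underlying k M)) :
    PreservesColimitsOfSize.{v, v} (evBig (k := k) f) :=
  ⟨⟨fun {F} => by
    obtain ⟨c, ⟨hc⟩, -, h⟩ := exists_colimitCocone hco F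
    exact preservesColimit_of_preserves_colimit_cocone hc (h f).some⟩⟩

end

end PartialFactorization

end

end DGCategory
/-! # The ordinary small object argument -/

section

variable {C : Type u} [Category.{v} C]

/-- If the domains of a small class `I` are small relative to the relative `I`-cell complexes,
there is a regular cardinal controlling the smallness of all of them. -/
lemma exists_regular_preservesColimit (I : MorphismProperty C) [MorphismProperty.IsSmall.{v} I]
    (hI : ∀ ⦃A B : C⦄ (i : A ⟶ B), I i → IsSmallRelativeTo (relativeCellComplexes I) A) :
    ∃ μ : Cardinal.{v}, μ.IsRegular ∧ ∀ ⦃A B : C⦄ (i : A ⟶ B), I i →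
      ∀ F : μ.ord.ToType ⥤ C, F.IsWellOrderContinuous →
        (∀ j : μ.ord.ToType, ¬ IsMax j →
          relativeCellComplexes I (F.map (homOfLE (Order.le_succ j)))) →
        PreservesColimit F (coyoneda.obj (Opposite.op A)) := by
  obtain ⟨ι, A, B, f, rfl⟩ := (MorphismProperty.isSmall_iff_eq_ofHoms.{v} I).1 inferInstance
  choose κ hκ using fun i => hI (f i) ⟨i⟩
  -- Successors of infinite cardinals are regular, and the sum bounds every individual `κ i`.
  have hμ : (Order.succ (max Cardinal.aleph0 (Cardinal.sum κ))).IsRegular :=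
    Cardinal.isRegular_succ (le_max_left _ _)
  refine ⟨_, hμ, ?_⟩
  rintro _ _ _ ⟨i⟩ F hF hF'
  exact hκ i _ ((Cardinal.le_sum κ i).trans ((le_max_right _ _).trans (Order.le_succ _)))
    hμ F hF hF'

/-- The ordinary small object argument. -/
lemma exists_cellComplex_rlp_factorization [HasColimits C] (I : MorphismProperty C)
    [MorphismProperty.IsSmall.{v} I]
    (hI : ∀ ⦃A B : C⦄ (i : A ⟶ B), I i → IsSmallRelativeTo (relativeCellComplexes I) A)
    {X Y : C} (f : X ⟶ Y) :
    ∃ (Z : C) (c : X ⟶ Z) (p : Z ⟶ Y), relativeCellComplexes I c ∧ I.rlp p ∧ c ≫ p = f := by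
  obtain ⟨μ, hμ, h⟩ := exists_regular_preservesColimit I hI
  have : Fact μ.IsRegular := ⟨hμ⟩
  let : OrderBot μ.ord.ToType :=
    have : Nonempty μ.ord.ToType := Ordinal.nonempty_toType_iff.2 (by
      rw [ne_eq, Cardinal.ord_eq_zero]; exact hμ.ne_zero)
    WellFoundedLT.toOrderBot _
  have : I.IsCardinalForSmallObjectArgument μ :=
    { preservesColimit := fun i hi f hf => h i hi hf.F inferInstance fun j hj => by
        -- A single pushout of a coproduct of generators is already a relative cell complex.
        refine MorphismProperty.le_transfiniteCompositions _ _ ?_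
        have := (hf.attachCells j hj).pushouts_coproducts
        rwa [MorphismProperty.ofHoms_homFamily] at this }
  exact ⟨_, SmallObject.ιObj I μ f, SmallObject.πObj I μ f,
    MorphismProperty.transfiniteCompositionsOfShape_le_transfiniteCompositions _ _ _
      (SmallObject.transfiniteCompositionsOfShape_ιObj I μ f),
    SmallObject.rlp_πObj I μ f, SmallObject.ιObj_πObj I μ f⟩

end

/-! # The enriched small object argument -/

namespace DGCategory

namespace PartialFactorization

section

variable {k : Type v} [CommRing k] {M : Type u} [DGCategory k M]

/-- The dg functor sending an arrow `f` to the projection `mid f ⟶ f.right`. -/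
noncomputable def projFunctor (E : PartialFactorization k M) :
    DGFunctor k (Arrow (Underlying k M)) (Arrow (Underlying k M)) where
  obj f := Arrow.mk (E.R f)
  map f g :=
    { f := fun n => ModuleCat.ofHom (LinearMap.codRestrict
        (arrowHom (Arrow.mk (E.R f)) (Arrow.mk (E.R g)) n)
        (((E.mid.map f g).f n).hom.prod (rightHom k f g n)) (fun s => E.R_naturality s))
      comm' := fun i j _ => by
        apply ModuleCat.hom_ext
        exact LinearMap.ext fun s => arrowHom_ext (x := Arrow.mk (E.R f)) (y := Arrow.mk (E.R g))
          (comm_apply (E.mid.map f g) i j s) (d_rightHom i j s) }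
  map_id f := arrowHom_ext (x := Arrow.mk (E.R f)) (y := Arrow.mk (E.R f)) (E.mid.map_id f) rfl
  map_comp {f g h} p q n e s t := arrowHom_ext (x := Arrow.mk (E.R f)) (y := Arrow.mk (E.R h))
    (E.mid.map_comp p q n e s t) rfl

variable (k M) in
/-- The partial enriched factorization `f.left ⟶ f.right`. -/
noncomputable def initial : PartialFactorization k M where
  mid :=
    { obj := fun f => f.left.as
      map := fun f g =>
        { f := fun n => ModuleCat.ofHom (leftHom k f g n) }
      map_id := fun _ => rfl
      map_comp := fun _ _ _ _ _ _ => rfl }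
  R f := f.hom
  R_naturality s := pre_rightHom s
  big f := f.left
  sec f := 𝟙 _
  ret f := 𝟙 _
  sec_ret f := Category.id_comp _

/-- The morphisms of partial enriched factorizations which behave like a cell attachment: their
components have the left lifting property, they become relative cell complexes on the big objects,
and they solve lifting problems. -/
def IsCellular (I : MorphismProperty (Underlying k M)) : MorphismProperty (PartialFactorization k M) :=
  fun E E' φ => (∀ f, I.rlp.llp (φ.app f)) ∧ (∀ f, relativeCellComplexes I (φ.big f)) ∧
    ∀ (f : Arrow (Underlying k M)) ⦃A B : Underlying k M⦄ (i : A ⟶ B) (_ : I i)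
      (a : A ⟶ .of (E.mid.obj f)) (b : B ⟶ f.right), i ≫ b = a ≫ E.R f →
      ∃ l : B ⟶ .of (E'.mid.obj f), i ≫ l = a ≫ φ.app f ∧ l ≫ E'.R f = b

end

section

variable {k : Type v} [Field k] {M : Type u} [DGCategory k M]
  (hM : IsStronglyPretriangulated k M) (hbi : IsBicomplete k M)
  (I : MorphismProperty (Underlying k M)) [MorphismProperty.IsSmall.{v} I]
  (hI : ∀ ⦃A B : Underlying k M⦄ (i : A ⟶ B), I i →
    IsSmallRelativeTo (relativeCellComplexes I) A)
  (hI' : hM.Stable I.rlp.llp)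

include hM hbi hI hI'

/-- The successor step of the iteration: the dg functor is the cell attachment on the projection
`E.R f`. The new big object is obtained by the ordinary small object argument and contains the new
middle object as a retract by the retract argument. -/
lemma exists_isCellular (E : PartialFactorization k M) :
    ∃ (E' : PartialFactorization k M) (φ : E ⟶ E'), IsCellular I φ := by
  have := hbi.hasColimits
  obtain ⟨ι, A, B, g, rfl⟩ := (MorphismProperty.isSmall_iff_eq_ofHoms.{v} I).1 inferInstance
  let I' (i : ι) : Arrow (Underlying k M) := Arrow.mk (g i)
  let C (x : Arrow (Underlying k M)) : CellAttachment I' x :=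
    (hbi.nonempty_cellAttachment I' x).some
  let inl (f : Arrow (Underlying k M)) : Underlying.of (E.mid.obj f) ⟶
    (C (Arrow.mk (E.R f))).obj := (C (Arrow.mk (E.R f))).inl
  have hinl : ∀ f, (MorphismProperty.ofHoms g).rlp.llp (inl f) := fun f => by
    have := (C (Arrow.mk (E.R f))).llp_inl hM hI'
      (fun i => MorphismProperty.le_llp_rlp _ _ ⟨i⟩)
    -- Stability is known for the saturation `I.rlp.llp`, which has the same right lifting class as
    -- the generators.
    rwa [MorphismProperty.rlp_llp_rlp] at this
  -- The old big object maps to the new middle object through `ret`. Factoring this map as a cell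
  -- complex `c` followed by `p` in `I.rlp` makes `p` the new retraction; its section is a lift
  -- against `inl`, chosen to be compatible with `c`.
  choose Z c p hc hp hcp using fun f => exists_cellComplex_rlp_factorization _ hI
    (E.ret f ≫ inl f)
  have sq : ∀ f, CommSq (E.sec f ≫ c f) (inl f) (p f) (𝟙 _) := fun f => ⟨by
    rw [Category.assoc, hcp, ← Category.assoc, E.sec_ret, Category.id_comp, Category.comp_id]⟩
  have hsq : ∀ f, ∃ l, inl f ≫ l = E.sec f ≫ c f ∧ l ≫ p f = 𝟙 _ := fun f => by
    have := hinl f _ (hp f)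
    exact ⟨(sq f).lift, (sq f).fac_left, (sq f).fac_right⟩
  choose l hl hl' using hsq
  let E' : PartialFactorization k M :=
    { mid := E.projFunctor.comp (CellAttachment.functor C)
      R := fun f => (C (Arrow.mk (E.R f))).proj
      R_naturality := fun {f g n} s => CellAttachment.proj_naturality (C := C)
        (((E.projFunctor.map f g).f n).hom s)
      big := Z
      sec := l
      ret := p
      sec_ret := hl' }
  let φ : E ⟶ E' :=
    { app := inl
      big := c
      naturality := fun {f g n} s => CellAttachment.pre_inl_map (C := C)
        (((E.projFunctor.map f g).f n).hom s)
      app_R := fun f => (C (Arrow.mk (E.R f))).inl_proj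
      sec_big := fun f => (hl f).symm
      big_ret := hcp }
  refine ⟨E', φ, hinl, hc, ?_⟩
  rintro f _ _ _ ⟨i⟩ a b h
  exact (C (Arrow.mk (E.R f))).exists_lift i a b h

/-- The enriched small object argument. -/
theorem exists_enrichedFactorization : ∃ F : EnrichedFactorization k M,
    ∀ f : Arrow (Underlying k M), I.rlp.llp (F.L f) ∧ I.rlp (F.R f) := by
  have := hbi.hasColimits
  have := hasColimits hbi.cotensored
  obtain ⟨μ, hμ, small⟩ := exists_regular_preservesColimit I hI
  let : OrderBot μ.ord.ToType :=
    have : Nonempty μ.ord.ToType := Ordinal.nonempty_toType_iff.2 (by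
      rw [ne_eq, Cardinal.ord_eq_zero]; exact hμ.ne_zero)
    WellFoundedLT.toOrderBot _
  -- Without a maximum, each stage of the iteration is followed by one solving its lifting problems.
  have : NoMaxOrder μ.ord.ToType := Cardinal.noMaxOrder hμ.aleph0_le
  choose succ toSucc hsucc using exists_isCellular hM hbi I hI hI'
  let Φ : SmallObject.SuccStruct (PartialFactorization k M) := ⟨initial k M, succ, toSucc⟩
  have hΦ : Φ.prop ≤ IsCellular I := by
    rintro _ _ _ ⟨_⟩
    exact hsucc _
  let t := (Φ.transfiniteCompositionOfShapeιIteration μ.ord.ToType).ofLE hΦ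
  let ι := Φ.ιIteration μ.ord.ToType
  let E := Φ.iteration μ.ord.ToType
  refine ⟨
    { mid := E.mid
      L := fun f => Hom.app ι f
      R := E.R
      fac := fun f => Hom.app_R ι f
      L_naturality := fun f g n s => Hom.naturality ι s
      R_naturality := fun f g n s => E.R_naturality s }, fun f => ⟨?_, ?_⟩⟩
  · have := preservesColimits_evMid (k := k) hbi.cotensored f
    have : PreservesWellOrderContinuousOfShape μ.ord.ToType (evMid f) := ⟨fun _ _ => inferInstance⟩
    have h : IsCellular I ≤ I.rlp.llp.inverseImage (evMid f) := fun _ _ φ hφ => hφ.1 f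
    exact I.rlp.llp.transfiniteCompositionsOfShape_le _ _ ((t.ofLE h).map (F := evMid f)).mem
  · have := preservesColimits_evBig (k := k) hbi.cotensored f
    have : PreservesWellOrderContinuousOfShape μ.ord.ToType (evBig f) := ⟨fun _ _ => inferInstance⟩
    have h : IsCellular I ≤ (relativeCellComplexes I).inverseImage (evBig f) :=
      fun _ _ φ hφ => hφ.2.1 f
    let t' := (t.ofLE h).map (F := evBig f)
    intro A B i hi
    have : PreservesColimit (t.F ⋙ evBig f) (coyoneda.obj (Opposite.op A)) :=
      small i hi t'.F inferInstance t'.map_mem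
    refine ⟨fun {a b} sq => ?_⟩
    -- The map `a` is sent by `sec` to the colimit of the big objects, whose transition maps are
    -- relative cell complexes, so smallness of `A` factors it through stage `j`.
    obtain ⟨j, a', ha'⟩ := Types.jointly_surjective _
      (isColimitOfPreserves (coyoneda.obj (Opposite.op A))
        (isColimitOfPreserves (evBig f) t.isColimit)) (a ≫ E.sec f)
    let τ : t.F.obj j ⟶ E := t.incl.app j
    let a₁ : A ⟶ (t.F.obj j).big f := a'
    replace ha' : a₁ ≫ Hom.big τ f = a ≫ E.sec f := ha'
    -- Retracting gives a factorization of `a` itself through the middle object of stage `j`,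
    -- because `sec` followed by `ret` is the identity in the colimit.
    let a'' : A ⟶ .of ((t.F.obj j).mid.obj f) := a₁ ≫ (t.F.obj j).ret f
    have ha'' : a'' ≫ Hom.app τ f = a := by
      dsimp only [a'']
      rw [Category.assoc, ← Hom.big_ret, ← Category.assoc, ha', Category.assoc, E.sec_ret,
        Category.comp_id]
    let σ := t.F.map (homOfLE (Order.le_succ j))
    let τ' : t.F.obj (Order.succ j) ⟶ E := t.incl.app (Order.succ j)
    have hσ : σ ≫ τ' = τ := (t.incl.naturality _).trans (Category.comp_id _)
    -- The attachment at stage `j` solves the lifting problem at the successor stage.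
    obtain ⟨l, hl, hl'⟩ := (t.map_mem j (not_isMax j)).2.2 f i hi a'' b (by
      rw [← Hom.app_R τ f, ← Category.assoc, ha'', sq.w])
    refine ⟨⟨⟨l ≫ Hom.app τ' f, ?_, ?_⟩⟩⟩
    · rw [← Category.assoc, hl, Category.assoc, ← ha'', ← hσ]
      rfl
    · rw [Category.assoc, Hom.app_R, hl']

end

end PartialFactorization

end DGCategory

/-- In a model category the cofibrations are the maps with the left lifting property against trivial
fibrations, and dually for trivial cofibrations and fibrations. Hence `I.rlp.llp` and `J.rlp.llp`
are the two stable classes, and the enriched small object argument applies to each generating set.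
-/
theorem theoremt (k : Type v) [Field k] (M : Type u) [DGCategory k M]
    (hM : DGCategory.IsStronglyPretriangulated k M)
    (hbi : DGCategory.IsBicomplete k M)
    [ModelCategory (DGCategory.Underlying k M)]
    (hgen : IsCofibrantlyGenerated (DGCategory.Underlying k M))
    (hcof_shift : ∀ (n : ℤ) ⦃E F : DGCategory.Underlying k M⦄ (i : E ⟶ F),
      cofibrations _ i → cofibrations _ ((hM.shiftFunctor n).map i))
    (htriv_shift : ∀ (n : ℤ) ⦃E F : DGCategory.Underlying k M⦄ (i : E ⟶ F),
      trivialCofibrations _ i → trivialCofibrations _ ((hM.shiftFunctor n).map i))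
    (hcof_iCone : ∀ ⦃E F : DGCategory.Underlying k M⦄ (i : E ⟶ F),
      cofibrations _ i → cofibrations _ (hM.iCone.map i))
    (htriv_iCone : ∀ ⦃E F : DGCategory.Underlying k M⦄ (i : E ⟶ F),
      trivialCofibrations _ i → trivialCofibrations _ (hM.iCone.map i)) :
    DGCategory.AdmitsEnrichedFactorizations k M := by
  obtain ⟨I, J, hI, hJ, smallI, smallJ, eI, eJ⟩ := hgen
  have hI' : I.rlp.llp = cofibrations (DGCategory.Underlying k M) := by
    rw [← eI, trivialFibrations_llp]
  have hJ' : J.rlp.llp = trivialCofibrations (DGCategory.Underlying k M) := by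
    rw [← eJ, fibrations_llp]
  constructor
  · rw [← hI', eI]
    refine DGCategory.PartialFactorization.exists_enrichedFactorization hM hbi I smallI ?_
    rw [hI']
    exact ⟨hcof_shift, hcof_iCone⟩
  · rw [← hJ', eJ]
    refine DGCategory.PartialFactorization.exists_enrichedFactorization hM hbi J smallJ ?_
    rw [hJ']
    exact ⟨htriv_shift, htriv_iCone⟩
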